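/- Let $\mathbb K=\mathbb R$ or $\mathbb C$ and let $(L,A)$ be a Lie pair over a smooth manifold $M$: an inclusion $i\colon A\hookrightarrow L$ of $\mathbb K$-Lie algebroids over $M$, with quotient bundle $B=L/A$. Fix a splitting of $0\to A\xrightarrow{i}L\xrightarrow{\mathrm{pr}_B}B\to0$, i.e. bundle maps $j\colon B\to L$ and $\mathrm{pr}_A\colon L\to A$ with $\mathrm{pr}_B\,j=\mathrm{id}$, $\mathrm{pr}_A\,i=\mathrm{id}$, $i\,\mathrm{pr}_A+j\,\mathrm{pr}_B=\mathrm{id}$. Let $\mathscr A$ be a local Artinian $\mathbb K$-algebra with maximal ideal $\mathfrak m$ and residue field $\mathbb K$, and let $\mathrm{ev}\colon\mathscr A\to\mathbb K$ be the evaluation. For a vector bundle $E$ put $\Gamma(E_{\mathscr A})=\Gamma(E)\otimes_{\mathbb K}\mathscr A$; the center of an $\mathscr A$-linear map $\Gamma(E_{\mathscr A})\to\Gamma(F_{\mathscr A})$ is its composition with $\mathrm{ev}$ restricted to $\Gamma(E)$. **Extended $L_\infty$-algebra.** Let $\mathfrak h=(\mathrm{Der}(L)\oplus\Gamma(B))\oplus\bigoplus_{n\ge1}\Gamma(\wedge^nA^*\otimes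 B)$ be the extended cubic $L_\infty$-algebra of $(L,A)$, where $\mathrm{Der}(L)$ is the space of Lie algebroid derivations $\delta$ of $L$ (with symbol). For $\delta\in\mathrm{Der}(L)$, $b\in\Gamma(B)$, $X,Y\in\mathfrak h^1=\Gamma(A^*\otimes B)$ and $a,a_1,a_2\in\Gamma(A)$ (viewed in $\Gamma(L)$ through $i$), its brackets are $$[\delta]_1(a)=-\mathrm{pr}_B\delta(a),\quad [\delta,X]_2(a)=\mathrm{pr}_B\delta jX(a)-X(\mathrm{pr}_A\delta(a)),\quad [\delta,X,Y]_3=Y\,\mathrm{pr}_A\delta j\,X+X\,\mathrm{pr}_A\delta j\,Y,$$ $$[b]_1(a)=\mathrm{pr}_B[a,jb],\quad [b,X]_2(a)=\mathrm{pr}_B[jb,jX(a)]-X(\mathrm{pr}_A[jb,a]),\quad [b,X,Y]_3(a)=Y(\mathrm{pr}_A[jb,jX(a)])+X(\mathrm{pr}_A[jb,jY(a)]),$$ $$[X]_1(a_1,a_2)=\mathrm{pr}_B[a_1,jX(a_2)]-\mathrm{pr}_B[a_2,jX(a_1)]-X([a_1,a_2]_A),$$ $$\tfrac1{2!}[X,X]_2(a_1,a_2)=\mathrm{pr}_B[jX(a_1),jX(a_2)]-X(\mathrm{pr}_A[jX(a_1),a_2])-X(\mathrm{pr}_A[a_1,jX(a_2)]),$$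 $$\tfrac1{3!}[X,X,X]_3(a_1,a_2)=-X(\mathrm{pr}_A[jX(a_1),jX(a_2)]),$$ the last two being polarized symmetrically. The brackets are extended $\mathscr A$-multilinearly to $\mathfrak h\otimes\mathfrak m$. A Maurer–Cartan element is $\xi\in\Gamma(A^*\otimes B)\otimes\mathfrak m$ with $[\xi]_1+\frac1{2!}[\xi,\xi]_2+\frac1{3!}[\xi,\xi,\xi]_3=0$. Maurer–Cartan elements $\xi,\eta$ are gauge equivalent if there is $b\in\mathfrak h^0\otimes\mathfrak m=(\mathrm{Der}(L)\oplus\Gamma(B))\otimes\mathfrak m$ with $$\eta=e^b*\xi:=\xi-\sum_{k\ge1}\frac1{k!}e^k_\xi(b),\qquad e^1_\xi(b)=[b]_1-[b,\xi]_2+\tfrac12[b,\xi,\xi]_3,$$ $$e^{k+1}_\xi(b)=[b,e^k_\xi(b)]_2-[b,\xi,e^k_\xi(b)]_3+\frac12\sum_{k_1+k_2=k,\ k_i\ge1}\frac{k!}{k_1!\,k_2!}[b,e^{k_1}_\xi(b),e^{k_2}_\xi(b)]_3\quad(k\ge1).$$ **Deformations.** Let $L^0_{\mathscr A}$ be the $\mathscr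 A$-linear extension of the Lie algebroid $L$. An $\mathscr A$-ringed Lie algebroid structure on $A_{\mathscr A}$ consists of an $\mathscr A$-bilinear Lie bracket on $\Gamma(A_{\mathscr A})$ and a $C^\infty(M,\mathbb K)\otimes\mathscr A$-linear anchor to $\Gamma(T_M\otimes\mathbb K)\otimes\mathscr A$ satisfying the Leibniz rule. A morphism of $\mathscr A$-ringed Lie algebroids is a pair $(\Pi,\lambda)$ of an $\mathscr A$-linear map $\Pi$ of sections and an $\mathscr A$-algebra endomorphism $\lambda$ of $C^\infty(M,\mathbb K)\otimes\mathscr A$ with center $\mathrm{id}$, such that $\Pi(fu)=\lambda(f)\Pi(u)$, $\Pi$ preserves brackets, and $\lambda\langle\rho(u),f\rangle=\langle\rho'(\Pi u),\lambda f\rangle$. A small automorphism of $L^0_{\mathscr A}$ is a morphism from $L^0_{\mathscr A}$ to itself whose center is $\mathrm{id}_L$. An infinitesimal deformation of $(L,A)$ over $\mathscr A$ is an $\mathscr A$-ringed Lie algebroid structure on $A_{\mathscr A}$ with center $A$, together with a morphism $(I,\lambda)\colon A_{\mathscr A}\to L^0_{\mathscr A}$ with center $i$. Two of them, $(I,\lambda)$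 and $(I',\lambda')$, are weakly isomorphic if there are a small automorphism $\Phi$ of $L^0_{\mathscr A}$ and a morphism $\Phi_A$ of $\mathscr A$-ringed Lie algebroids from the source of $I'$ to the source of $I$ such that $\Phi\circ I'=I\circ\Phi_A$ as morphisms (pairs). For $\xi\in\Gamma(A^*\otimes B)\otimes\mathfrak m$ let $I_\xi=i+j\xi$ (covering $\lambda=\mathrm{id}$), where $A_{\mathscr A}$ carries the bracket $\mathrm{pr}_A[I_\xi a_1,I_\xi a_2]$ and the anchor $\rho_L\circ I_\xi$. **Statement.** Let $\xi,\eta$ be Maurer–Cartan elements of $\mathfrak h\otimes\mathfrak m$. Then $I_\xi$ and $I_\eta$ are infinitesimal deformations of $(L,A)$ (the associated standard deformations), and $\xi$ and $\eta$ are gauge equivalent if and only if $I_\xi$ and $I_\eta$ are weakly isomorphic. -/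

import Mathlib

open scoped TensorProduct ContDiff Manifold Bundle

noncomputable section

namespace LiePairs

/-! ## Lie algebroids and Lie pairs in terms of sections

Throughout, `R` stands for `C^∞(M, 𝕂)` and `Γ`, `ΓA`, `ΓL`, `ΓB` for modules of sections. -/

section Algebroids

variable (𝕂 : Type*) [Field 𝕂] (R : Type*) [CommRing R] [Algebra 𝕂 R]
  (Γ : Type*) [AddCommGroup Γ] [Module 𝕂 Γ] [Module R Γ] [IsScalarTower 𝕂 R Γ]

/-- A Lie algebroid structure on a vector bundle with module of sections `Γ`: a `𝕂`-bilinear Lie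
bracket on sections and a `C^∞`-linear anchor with values in the `𝕂`-valued vector fields
`Γ(T_M ⊗ 𝕂) = Der_𝕂 C^∞(M, 𝕂)`, which is a morphism of Lie algebras and satisfies the Leibniz
identity. -/
structure LieAlgebroidStr where
  bracket : Γ →ₗ[𝕂] Γ →ₗ[𝕂] Γ
  anchor : Γ →ₗ[R] Derivation 𝕂 R R
  bracket_self : ∀ u, bracket u u = 0
  jacobi : ∀ u v w, bracket u (bracket v w) = bracket (bracket u v) w + bracket v (bracket u w)
  anchor_bracket : ∀ u v, anchor (bracket u v) = ⁅anchor u, anchor v⁆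
  leibniz : ∀ (u v : Γ) (f : R), bracket u (f • v) = anchor u f • v + f • bracket u v

variable {𝕂 R Γ}

theorem LieAlgebroidStr.skew (E : LieAlgebroidStr 𝕂 R Γ) (u v : Γ) :
    E.bracket u v = - E.bracket v u := by
  have h := E.bracket_self (u + v)
  simp only [map_add, LinearMap.add_apply, E.bracket_self, zero_add, add_zero] at h
  exact eq_neg_of_add_eq_zero_right h

theorem LieAlgebroidStr.leibniz_left (E : LieAlgebroidStr 𝕂 R Γ) (u v : Γ) (f : R) :
    E.bracket (f • u) v = f • E.bracket u v - E.anchor v f • u := by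
  rw [E.skew, E.leibniz, E.skew u v, smul_neg]; abel

/-- The space `Der(E)` of derivations of a Lie algebroid: pairs of a `𝕂`-linear operator on
sections and a vector field, its symbol. -/
def LieAlgebroidStr.Der (E : LieAlgebroidStr 𝕂 R Γ) :
    Submodule 𝕂 (Module.End 𝕂 Γ × Derivation 𝕂 R R) where
  carrier := {δ | (∀ (f : R) (u : Γ), δ.1 (f • u) = δ.2 f • u + f • δ.1 u) ∧
    (∀ u, ⁅δ.2, E.anchor u⁆ = E.anchor (δ.1 u)) ∧
    (∀ u v, δ.1 (E.bracket u v) = E.bracket (δ.1 u) v + E.bracket u (δ.1 v))}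
  add_mem' := by
    rintro δ δ' ⟨h1, h2, h3⟩ ⟨k1, k2, k3⟩
    refine ⟨fun f u => ?_, fun u => ?_, fun u v => ?_⟩
    · simp only [Prod.fst_add, Prod.snd_add, LinearMap.add_apply, Derivation.add_apply, h1, k1,
        add_smul, smul_add]
      abel
    · simp only [Prod.fst_add, Prod.snd_add, LinearMap.add_apply, map_add, add_lie, h2, k2]
    · simp only [Prod.fst_add, LinearMap.add_apply, map_add, h3, k3]
      abel
  zero_mem' := by
    refine ⟨fun f u => ?_, fun u => ?_, fun u v => ?_⟩ <;> simp
  smul_mem' := by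
    rintro c δ ⟨h1, h2, h3⟩
    refine ⟨fun f u => ?_, fun u => ?_, fun u v => ?_⟩
    · simp only [Prod.smul_fst, Prod.smul_snd, LinearMap.smul_apply, Derivation.smul_apply, h1,
        smul_add, smul_assoc]
      rw [smul_comm c f]
    · simp only [Prod.smul_fst, Prod.smul_snd, LinearMap.smul_apply, smul_lie, h2]
      rw [← algebraMap_smul R c (δ.1 u), map_smul, algebraMap_smul]
    · simp only [Prod.smul_fst, LinearMap.smul_apply, map_smul, h3, smul_add]

end Algebroids

section Pairs

variable (𝕂 : Type*) [Field 𝕂] (R : Type*) [CommRing R] [Algebra 𝕂 R]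
  (ΓA : Type*) [AddCommGroup ΓA] [Module 𝕂 ΓA] [Module R ΓA] [IsScalarTower 𝕂 R ΓA]
  (ΓL : Type*) [AddCommGroup ΓL] [Module 𝕂 ΓL] [Module R ΓL] [IsScalarTower 𝕂 R ΓL]
  (ΓB : Type*) [AddCommGroup ΓB] [Module 𝕂 ΓB] [Module R ΓB] [IsScalarTower 𝕂 R ΓB]

/-- On sections: a Lie pair `(L, A)`, i.e. an inclusion `i` of Lie algebroids, the quotient
`B = L / A` with projection `prB`, and a splitting of `0 → A → L → B → 0` given by
`j : B → L` and `prA : L → A`. -/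
structure SplitPair where
  LA : LieAlgebroidStr 𝕂 R ΓA
  LL : LieAlgebroidStr 𝕂 R ΓL
  i : ΓA →ₗ[R] ΓL
  prB : ΓL →ₗ[R] ΓB
  j : ΓB →ₗ[R] ΓL
  prA : ΓL →ₗ[R] ΓA
  prB_i : ∀ a, prB (i a) = 0
  prB_j : ∀ b, prB (j b) = b
  prA_i : ∀ a, prA (i a) = a
  decomp : ∀ l, i (prA l) + j (prB l) = l
  i_bracket : ∀ a a', i (LA.bracket a a') = LL.bracket (i a) (i a')
  i_anchor : ∀ a, LL.anchor (i a) = LA.anchor a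

variable {𝕂 R ΓA ΓL ΓB}

theorem SplitPair.prA_j (P : SplitPair 𝕂 R ΓA ΓL ΓB) (b : ΓB) : P.prA (P.j b) = 0 := by
  have h := congrArg P.prA (P.decomp (P.j b))
  simpa [P.prA_i, P.prB_j] using h

end Pairs

/-! ## Extension of scalars to an algebra `𝒜`

For a `𝕂`-vector space `X`, the space `X ⊗ 𝒜` is written `𝒜 ⊗[𝕂] X`. -/

section Extension

variable {𝕂 : Type*} [Field 𝕂] (𝒜 : Type*) [CommRing 𝒜] [Algebra 𝕂 𝒜]
  {X Y Z W : Type*} [AddCommGroup X] [Module 𝕂 X] [AddCommGroup Y] [Module 𝕂 Y]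
  [AddCommGroup Z] [Module 𝕂 Z] [AddCommGroup W] [Module 𝕂 W]

variable (X Y) in
/-- The application map `(a ⊗ φ, b ⊗ x) ↦ ab ⊗ φ x`. -/
def extApp : 𝒜 ⊗[𝕂] (X →ₗ[𝕂] Y) →ₗ[𝒜] 𝒜 ⊗[𝕂] X →ₗ[𝒜] 𝒜 ⊗[𝕂] Y :=
  (LinearMap.baseChangeHom 𝕂 𝒜 X Y).liftBaseChange 𝒜

/-- The `𝒜`-bilinear extension `(a ⊗ x, b ⊗ y) ↦ ab ⊗ β x y` of a bilinear map. -/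
def ext₂ (β : X →ₗ[𝕂] Y →ₗ[𝕂] Z) : 𝒜 ⊗[𝕂] X →ₗ[𝒜] 𝒜 ⊗[𝕂] Y →ₗ[𝒜] 𝒜 ⊗[𝕂] Z :=
  extApp 𝒜 Y Z ∘ₗ β.baseChange 𝒜

/-- The `𝒜`-trilinear extension of a trilinear map. -/
def ext₃ (τ : X →ₗ[𝕂] Y →ₗ[𝕂] Z →ₗ[𝕂] W) (x : 𝒜 ⊗[𝕂] X) (y : 𝒜 ⊗[𝕂] Y) :
    𝒜 ⊗[𝕂] Z →ₗ[𝒜] 𝒜 ⊗[𝕂] W :=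
  extApp 𝒜 Z W (ext₂ 𝒜 τ x y)

theorem ext₂_tmul (β : X →ₗ[𝕂] Y →ₗ[𝕂] Z) (a b : 𝒜) (x : X) (y : Y) :
    ext₂ 𝒜 β (a ⊗ₜ x) (b ⊗ₜ y) = (a * b) ⊗ₜ β x y := by
  simp [ext₂, extApp, TensorProduct.smul_tmul']

variable (𝕂 X) in
/-- The subspace `X ⊗ 𝔪` of `X ⊗ 𝒜`, where `𝔪` is the maximal ideal of `𝒜`. -/
def mPart [IsLocalRing 𝒜] : Submodule 𝒜 (𝒜 ⊗[𝕂] X) :=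
  IsLocalRing.maximalIdeal 𝒜 • (⊤ : Submodule 𝒜 (𝒜 ⊗[𝕂] X))

variable {𝒜} in
variable (X) in
/-- The evaluation map `X ⊗ 𝒜 → X` at the maximal ideal, for `ev : 𝒜 → 𝒜 / 𝔪 = 𝕂`. -/
def evMap (ev : 𝒜 →ₐ[𝕂] 𝕂) : 𝒜 ⊗[𝕂] X →ₗ[𝕂] X :=
  (TensorProduct.lid 𝕂 X).toLinearMap ∘ₗ ev.toLinearMap.rTensor X

variable {𝒜} in
/-- The center `ev ∘ Π : X → Y` of an `𝒜`-linear map `Π : X ⊗ 𝒜 → Y ⊗ 𝒜`. -/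
def center (ev : 𝒜 →ₐ[𝕂] 𝕂) (Φ : 𝒜 ⊗[𝕂] X →ₗ[𝒜] 𝒜 ⊗[𝕂] Y) (x : X) : Y :=
  evMap Y ev (Φ (1 ⊗ₜ x))

end Extension

/-! ## Maurer–Cartan elements and gauge equivalence for cubic `L_∞`-algebras -/

section Cubic

variable (𝕂 : Type*) [Field 𝕂]
  (g₀ g₁ g₂ : Type*) [AddCommGroup g₀] [Module 𝕂 g₀] [AddCommGroup g₁] [Module 𝕂 g₁]
  [AddCommGroup g₂] [Module 𝕂 g₂]

/-- The components of the brackets of a cubic `L_∞`-algebra `g` that enter its Maurer–Cartan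
equation and the gauge action of `g⁰` on Maurer–Cartan elements (all in degrees `0`, `1`, `2`):
`[b]₁, [b, x]₂, [b, x, y]₃ ∈ g¹` and `[x]₁, [x, y]₂, [x, y, z]₃ ∈ g²` for `b ∈ g⁰` and
`x, y, z ∈ g¹`. The space `g₂` is any space containing the component of degree `2`. -/
structure CubicBrackets where
  d₀ : g₀ →ₗ[𝕂] g₁
  br₀₁ : g₀ →ₗ[𝕂] g₁ →ₗ[𝕂] g₁
  br₀₁₁ : g₀ →ₗ[𝕂] g₁ →ₗ[𝕂] g₁ →ₗ[𝕂] g₁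
  d₁ : g₁ →ₗ[𝕂] g₂
  br₁₁ : g₁ →ₗ[𝕂] g₁ →ₗ[𝕂] g₂
  br₁₁₁ : g₁ →ₗ[𝕂] g₁ →ₗ[𝕂] g₁ →ₗ[𝕂] g₂

variable {𝕂 g₀ g₁ g₂} (C : CubicBrackets 𝕂 g₀ g₁ g₂)
  {𝒜 : Type*} [CommRing 𝒜] [Algebra 𝕂 𝒜]

/-- `ξ` is a Maurer–Cartan element of `g ⊗ 𝔪`: it is an element of `g¹ ⊗ 𝔪` with
`[ξ]₁ + [ξ, ξ]₂ / 2! + [ξ, ξ, ξ]₃ / 3! = 0`. -/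
def CubicBrackets.IsMaurerCartan [IsLocalRing 𝒜] (ξ : 𝒜 ⊗[𝕂] g₁) : Prop :=
  ξ ∈ mPart 𝕂 𝒜 g₁ ∧
    C.d₁.baseChange 𝒜 ξ + (2 : 𝕂)⁻¹ • ext₂ 𝒜 C.br₁₁ ξ ξ + (6 : 𝕂)⁻¹ • ext₃ 𝒜 C.br₁₁₁ ξ ξ ξ = 0

/-- `[b]₁^ξ = [b]₁ + [ξ, b]₂ + [ξ, ξ, b]₃ / 2`, where by graded skew-symmetry
`[ξ, b]₂ = - [b, ξ]₂` and `[ξ, ξ, b]₃ = [b, ξ, ξ]₃`. -/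
def CubicBrackets.twisted₁ (ξ : 𝒜 ⊗[𝕂] g₁) (b : 𝒜 ⊗[𝕂] g₀) : 𝒜 ⊗[𝕂] g₁ :=
  C.d₀.baseChange 𝒜 b - ext₂ 𝒜 C.br₀₁ b ξ + (2 : 𝕂)⁻¹ • ext₃ 𝒜 C.br₀₁₁ b ξ ξ

/-- `[b, x]₂^ξ = [b, x]₂ + [ξ, b, x]₃`, where `[ξ, b, x]₃ = - [b, ξ, x]₃`. -/
def CubicBrackets.twisted₂ (ξ : 𝒜 ⊗[𝕂] g₁) (b : 𝒜 ⊗[𝕂] g₀) (x : 𝒜 ⊗[𝕂] g₁) : 𝒜 ⊗[𝕂] g₁ :=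
  ext₂ 𝒜 C.br₀₁ b x - ext₃ 𝒜 C.br₀₁₁ b ξ x

/-- `[b, x, y]₃^ξ = [b, x, y]₃`. -/
def CubicBrackets.twisted₃ (b : 𝒜 ⊗[𝕂] g₀) (x y : 𝒜 ⊗[𝕂] g₁) : 𝒜 ⊗[𝕂] g₁ :=
  ext₃ 𝒜 C.br₀₁₁ b x y

/-- The elements `e^k_ξ(b)`, with the convention `e^0_ξ(b) = -ξ`. For `k ≥ 1`,
`e^{k+1}_ξ(b) = ∑ₙ (1/n!) ∑_{k₁+⋯+kₙ=k, kᵢ≥1} k!/(k₁!⋯kₙ!) [b, e^{k₁}_ξ(b), …, e^{kₙ}_ξ(b)]^ξ_{n+1}`,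
where only `n = 1, 2` contribute; in the sum below `k₁ = p + 1` and `k₂ = k + 1 - k₁`. -/
def CubicBrackets.expTerm (ξ : 𝒜 ⊗[𝕂] g₁) (b : 𝒜 ⊗[𝕂] g₀) : ℕ → 𝒜 ⊗[𝕂] g₁
  | 0 => -ξ
  | 1 => C.twisted₁ ξ b
  | k + 2 => C.twisted₂ ξ b (expTerm ξ b (k + 1)) +
      (2 : 𝕂)⁻¹ • ∑ p : Fin k, ((k + 1).choose (p + 1) : 𝕂) •
        C.twisted₃ b (expTerm ξ b (p + 1)) (expTerm ξ b (k - p))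
  termination_by k => k
  decreasing_by all_goals omega

/-- The `L_∞`-exponential `e^b * ξ = ξ - ∑_{k ≥ 1} e^k_ξ(b) / k!`; the sum is finite for
`b ∈ g⁰ ⊗ 𝔪` with `𝔪` nilpotent. -/
def CubicBrackets.expAct (b : 𝒜 ⊗[𝕂] g₀) (ξ : 𝒜 ⊗[𝕂] g₁) : 𝒜 ⊗[𝕂] g₁ :=
  ξ - ∑ᶠ k : ℕ, (((k + 1).factorial : 𝕂)⁻¹) • C.expTerm ξ b (k + 1)

/-- Gauge equivalence: `η = e^b * ξ` for some `b ∈ g⁰ ⊗ 𝔪`. -/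
def CubicBrackets.GaugeEquivalent [IsLocalRing 𝒜] (ξ η : 𝒜 ⊗[𝕂] g₁) : Prop :=
  ∃ b ∈ mPart 𝕂 𝒜 g₀, η = C.expAct b ξ

end Cubic

/-! ## The extended cubic `L_∞`-algebra of a Lie pair -/

section Extended

variable {𝕂 : Type*} [Field 𝕂] {R : Type*} [CommRing R] [Algebra 𝕂 R]
  {ΓA : Type*} [AddCommGroup ΓA] [Module 𝕂 ΓA] [Module R ΓA] [IsScalarTower 𝕂 R ΓA]
  {ΓL : Type*} [AddCommGroup ΓL] [Module 𝕂 ΓL] [Module R ΓL] [IsScalarTower 𝕂 R ΓL]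
  {ΓB : Type*} [AddCommGroup ΓB] [Module 𝕂 ΓB] [Module R ΓB] [IsScalarTower 𝕂 R ΓB]
  (P : SplitPair 𝕂 R ΓA ΓL ΓB)

namespace SplitPair

/-- `[δ]₁ = - prB ∘ δ` on `Γ(A)`, for `δ ∈ Der(L)`. -/
def derD : P.LL.Der →ₗ[𝕂] (ΓA →ₗ[R] ΓB) where
  toFun δ :=
    { toFun := fun a => - P.prB (δ.1.1 (P.i a))
      map_add' := fun a a' => by simp only [map_add, neg_add]
      map_smul' := fun f a => by
        simp only [map_smul, δ.2.1, map_add, P.prB_i, smul_zero, zero_add, smul_neg,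
          RingHom.id_apply] }
  map_add' δ δ' := by
    ext a
    simp only [Submodule.coe_add, Prod.fst_add, LinearMap.add_apply, map_add, LinearMap.coe_mk,
      AddHom.coe_mk, neg_add]
  map_smul' c δ := by
    ext a
    simp only [Submodule.coe_smul, Prod.smul_fst, LinearMap.smul_apply, LinearMap.coe_mk,
      AddHom.coe_mk, RingHom.id_apply, LinearMap.map_smul_of_tower, smul_neg]

/-- `[δ, X]₂ = (prB ∘ δ ∘ j) ∘ X - X ∘ (prA ∘ δ)`, for `δ ∈ Der(L)` and `X ∈ Ω¹_A(B)`. -/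
def derBr₂ : P.LL.Der →ₗ[𝕂] (ΓA →ₗ[R] ΓB) →ₗ[𝕂] (ΓA →ₗ[R] ΓB) :=
  LinearMap.mk₂ 𝕂
    (fun δ X =>
      { toFun := fun a => P.prB (δ.1.1 (P.j (X a))) - X (P.prA (δ.1.1 (P.i a)))
        map_add' := fun a a' => by simp only [map_add]; abel
        map_smul' := fun f a => by
          simp only [map_smul, δ.2.1, map_add, P.prB_j, P.prA_i, RingHom.id_apply, smul_sub]
          abel })
    (fun δ δ' X => by
      ext a
      simp only [Submodule.coe_add, Prod.fst_add, LinearMap.add_apply, map_add, LinearMap.coe_mk,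
        AddHom.coe_mk]
      abel)
    (fun c δ X => by
      ext a
      simp only [Submodule.coe_smul, Prod.smul_fst, LinearMap.smul_apply, LinearMap.coe_mk,
        AddHom.coe_mk, LinearMap.map_smul_of_tower, smul_sub])
    (fun δ X Y => by
      ext a
      simp only [LinearMap.add_apply, map_add, LinearMap.coe_mk, AddHom.coe_mk]
      abel)
    (fun c δ X => by
      ext a
      simp only [LinearMap.smul_apply, LinearMap.coe_mk, AddHom.coe_mk, LinearMap.map_smul_of_tower,
        smul_sub])

/-- `θ_δ = prA ∘ δ ∘ j`, which is `C^∞`-linear. -/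
def derθ : P.LL.Der →ₗ[𝕂] (ΓB →ₗ[R] ΓA) where
  toFun δ :=
    { toFun := fun b => P.prA (δ.1.1 (P.j b))
      map_add' := fun a a' => by simp only [map_add]
      map_smul' := fun f a => by
        simp only [map_smul, δ.2.1, map_add, P.prA_j, smul_zero, zero_add, RingHom.id_apply] }
  map_add' δ δ' := by ext a; simp
  map_smul' c δ := by
    ext a
    simp only [Submodule.coe_smul, Prod.smul_fst, LinearMap.smul_apply, LinearMap.coe_mk,
      AddHom.coe_mk, RingHom.id_apply, LinearMap.map_smul_of_tower]

/-- For a linear family `θ` of bundle maps `B → A`: `(X, Y) ↦ Y ∘ θ ∘ X + X ∘ θ ∘ Y`. -/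
def symComp {D : Type*} [AddCommGroup D] [Module 𝕂 D] (θ : D →ₗ[𝕂] (ΓB →ₗ[R] ΓA)) :
    D →ₗ[𝕂] (ΓA →ₗ[R] ΓB) →ₗ[𝕂] (ΓA →ₗ[R] ΓB) →ₗ[𝕂] (ΓA →ₗ[R] ΓB) :=
  LinearMap.mk₂ 𝕂
    (fun δ X =>
      { toFun := fun Y => Y ∘ₗ θ δ ∘ₗ X + X ∘ₗ θ δ ∘ₗ Y
        map_add' := fun Y Y' => by ext a; simp; abel
        map_smul' := fun c Y => by
          ext a
          simp [LinearMap.map_smul_of_tower] })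
    (fun δ δ' X => by ext Y a; simp; abel)
    (fun c δ X => by ext Y a; simp [LinearMap.map_smul_of_tower])
    (fun δ X X' => by ext Y a; simp; abel)
    (fun c δ X => by ext Y a; simp [LinearMap.map_smul_of_tower])

/-- `[b]₁ = d_CE b : a ↦ ∇_a b = prB [a, j b]`, the Bott connection, for `b ∈ Γ(B)`. -/
def secD : ΓB →ₗ[𝕂] (ΓA →ₗ[R] ΓB) where
  toFun b :=
    { toFun := fun a => P.prB (P.LL.bracket (P.i a) (P.j b))
      map_add' := fun a a' => by simp only [map_add, LinearMap.add_apply]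
      map_smul' := fun f a => by
        simp only [map_smul, P.LL.leibniz_left, map_sub, P.prB_i, smul_zero, sub_zero,
          RingHom.id_apply] }
  map_add' b b' := by ext a; simp
  map_smul' c b := by ext a; simp [LinearMap.map_smul_of_tower]

/-- `[b, X]₂ : a ↦ prB [j b, j X(a)] - X (prA [j b, a])`, for `b ∈ Γ(B)`, `X ∈ Ω¹_A(B)`. -/
def secBr₂ : ΓB →ₗ[𝕂] (ΓA →ₗ[R] ΓB) →ₗ[𝕂] (ΓA →ₗ[R] ΓB) :=
  LinearMap.mk₂ 𝕂
    (fun b X =>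
      { toFun := fun a =>
          P.prB (P.LL.bracket (P.j b) (P.j (X a))) - X (P.prA (P.LL.bracket (P.j b) (P.i a)))
        map_add' := fun a a' => by simp only [map_add]; abel
        map_smul' := fun f a => by
          simp only [map_smul, P.LL.leibniz, map_add, P.prB_j, P.prA_i, RingHom.id_apply, smul_sub]
          abel })
    (fun b b' X => by ext a; simp; abel)
    (fun c b X => by ext a; simp [LinearMap.map_smul_of_tower, smul_sub])
    (fun b X Y => by ext a; simp; abel)
    (fun c b X => by ext a; simp [LinearMap.map_smul_of_tower, smul_sub])

/-- `θ_b = prA [j b, j -]`, which is `C^∞`-linear. -/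
def secθ : ΓB →ₗ[𝕂] (ΓB →ₗ[R] ΓA) where
  toFun b :=
    { toFun := fun b' => P.prA (P.LL.bracket (P.j b) (P.j b'))
      map_add' := fun a a' => by simp only [map_add]
      map_smul' := fun f a => by
        simp only [map_smul, P.LL.leibniz, map_add, P.prA_j, smul_zero, zero_add,
          RingHom.id_apply] }
  map_add' b b' := by ext a; simp
  map_smul' c b := by ext a; simp [LinearMap.map_smul_of_tower]

/-- `[X]₁ (a₁, a₂) = prB [a₁, j X(a₂)] - prB [a₂, j X(a₁)] - X [a₁, a₂]_A`. -/
def formD : (ΓA →ₗ[R] ΓB) →ₗ[𝕂] (ΓA →ₗ[𝕂] ΓA →ₗ[𝕂] ΓB) where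
  toFun X := LinearMap.mk₂ 𝕂
    (fun a₁ a₂ => P.prB (P.LL.bracket (P.i a₁) (P.j (X a₂)))
      - P.prB (P.LL.bracket (P.i a₂) (P.j (X a₁))) - X (P.LA.bracket a₁ a₂))
    (fun _ _ _ => by simp; abel)
    (fun _ _ _ => by simp [LinearMap.map_smul_of_tower, smul_sub])
    (fun _ _ _ => by simp; abel)
    (fun _ _ _ => by simp [LinearMap.map_smul_of_tower, smul_sub])
  map_add' X Y := by ext a₁ a₂; simp; abel
  map_smul' c X := by ext a₁ a₂; simp [LinearMap.map_smul_of_tower, smul_sub]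

/-- The bilinear map `(X, Y) ↦ [(a₁, a₂) ↦ prB [j X(a₁), j Y(a₂)] - X (prA [j Y(a₁), a₂])
- X (prA [a₁, j Y(a₂)])]`, whose symmetrization is the binary bracket on `Ω¹_A(B)`. -/
def halfBr₂ : (ΓA →ₗ[R] ΓB) →ₗ[𝕂] (ΓA →ₗ[R] ΓB) →ₗ[𝕂] (ΓA →ₗ[𝕂] ΓA →ₗ[𝕂] ΓB) :=
  LinearMap.mk₂ 𝕂
    (fun X Y => LinearMap.mk₂ 𝕂
      (fun a₁ a₂ => P.prB (P.LL.bracket (P.j (X a₁)) (P.j (Y a₂)))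
        - X (P.prA (P.LL.bracket (P.j (Y a₁)) (P.i a₂)))
        - X (P.prA (P.LL.bracket (P.i a₁) (P.j (Y a₂)))))
      (fun _ _ _ => by simp; abel)
      (fun _ _ _ => by simp [LinearMap.map_smul_of_tower, smul_sub])
      (fun _ _ _ => by simp; abel)
      (fun _ _ _ => by simp [LinearMap.map_smul_of_tower, smul_sub]))
    (fun _ _ _ => by ext a₁ a₂; simp; abel)
    (fun _ _ _ => by ext a₁ a₂; simp [LinearMap.map_smul_of_tower, smul_sub])
    (fun _ _ _ => by ext a₁ a₂; simp; abel)
    (fun _ _ _ => by ext a₁ a₂; simp [LinearMap.map_smul_of_tower, smul_sub])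

/-- `[X, Y]₂` for `X, Y ∈ Ω¹_A(B)`; in particular `[X, X]₂ / 2! (a₁, a₂) =
prB [j X(a₁), j X(a₂)] - X (prA [j X(a₁), a₂]) - X (prA [a₁, j X(a₂)])`. -/
def formBr₂ : (ΓA →ₗ[R] ΓB) →ₗ[𝕂] (ΓA →ₗ[R] ΓB) →ₗ[𝕂] (ΓA →ₗ[𝕂] ΓA →ₗ[𝕂] ΓB) :=
  P.halfBr₂ + P.halfBr₂.flip

/-- The trilinear map `(X, Y, Z) ↦ [(a₁, a₂) ↦ - X (prA [j Y(a₁), j Z(a₂)])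
- X (prA [j Z(a₁), j Y(a₂)])]`, whose cyclic sum is the ternary bracket on `Ω¹_A(B)`. -/
def thirdBr₃ : (ΓA →ₗ[R] ΓB) →ₗ[𝕂] (ΓA →ₗ[R] ΓB) →ₗ[𝕂] (ΓA →ₗ[R] ΓB) →ₗ[𝕂]
    (ΓA →ₗ[𝕂] ΓA →ₗ[𝕂] ΓB) :=
  LinearMap.mk₂ 𝕂
    (fun X Y =>
      { toFun := fun Z => LinearMap.mk₂ 𝕂
          (fun a₁ a₂ => - X (P.prA (P.LL.bracket (P.j (Y a₁)) (P.j (Z a₂))))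
            - X (P.prA (P.LL.bracket (P.j (Z a₁)) (P.j (Y a₂)))))
          (fun _ _ _ => by simp; abel)
          (fun _ _ _ => by simp [LinearMap.map_smul_of_tower, smul_sub])
          (fun _ _ _ => by simp; abel)
          (fun _ _ _ => by simp [LinearMap.map_smul_of_tower, smul_sub])
        map_add' := fun _ _ => by ext a₁ a₂; simp; abel
        map_smul' := fun _ _ => by ext a₁ a₂; simp [LinearMap.map_smul_of_tower, smul_sub] })
    (fun _ _ _ => by ext Z a₁ a₂; simp; abel)
    (fun _ _ _ => by ext Z a₁ a₂; simp [smul_sub])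
    (fun _ _ _ => by ext Z a₁ a₂; simp; abel)
    (fun _ _ _ => by ext Z a₁ a₂; simp [LinearMap.map_smul_of_tower, smul_sub])

/-- `[X, Y, Z]₃` for `X, Y, Z ∈ Ω¹_A(B)`; in particular
`[X, X, X]₃ / 3! (a₁, a₂) = - X (prA [j X(a₁), j X(a₂)])`. -/
def formBr₃ : (ΓA →ₗ[R] ΓB) →ₗ[𝕂] (ΓA →ₗ[R] ΓB) →ₗ[𝕂] (ΓA →ₗ[R] ΓB) →ₗ[𝕂]
    (ΓA →ₗ[𝕂] ΓA →ₗ[𝕂] ΓB) :=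
  LinearMap.mk₂ 𝕂
    (fun X Y => P.thirdBr₃ X Y + P.thirdBr₃.flip X Y + (P.thirdBr₃.flip X).flip Y)
    (fun _ _ _ => by ext Z a₁ a₂; simp; abel)
    (fun _ _ _ => by ext Z a₁ a₂; simp)
    (fun _ _ _ => by ext Z a₁ a₂; simp; abel)
    (fun _ _ _ => by ext Z a₁ a₂; simp)

/-- The extended cubic `L_∞`-algebra `𝔥 = (Der(L) ⊕ Γ(B)) ⊕ ⨁_{n ≥ 1} Ωⁿ_A(B)` of a Lie pair, in
the degrees needed for Maurer–Cartan elements and gauge equivalence: `𝔥⁰ = Der(L) × Γ(B)`,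
`𝔥¹ = Ω¹_A(B) = Γ(A* ⊗ B) = Hom_{C^∞}(Γ(A), Γ(B))`, and `𝔥² = Ω²_A(B)` inside the space of
`𝕂`-bilinear maps `Γ(A) × Γ(A) → Γ(B)`. -/
def extended : CubicBrackets 𝕂 (P.LL.Der × ΓB) (ΓA →ₗ[R] ΓB) (ΓA →ₗ[𝕂] ΓA →ₗ[𝕂] ΓB) where
  d₀ := P.derD.coprod P.secD
  br₀₁ := P.derBr₂.coprod P.secBr₂
  br₀₁₁ := (symComp P.derθ).coprod (symComp P.secθ)
  d₁ := P.formD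
  br₁₁ := P.formBr₂
  br₁₁₁ := P.formBr₃

/-- `ξ` is a Maurer–Cartan element of `𝔥 ⊗ 𝔪`. -/
def IsMaurerCartan {𝒜 : Type*} [CommRing 𝒜] [Algebra 𝕂 𝒜] [IsLocalRing 𝒜]
    (ξ : 𝒜 ⊗[𝕂] (ΓA →ₗ[R] ΓB)) : Prop :=
  P.extended.IsMaurerCartan ξ

/-- `ξ` and `η` are gauge equivalent in `𝔥 ⊗ 𝔪`. -/
def GaugeEquivalent {𝒜 : Type*} [CommRing 𝒜] [Algebra 𝕂 𝒜] [IsLocalRing 𝒜]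
    (ξ η : 𝒜 ⊗[𝕂] (ΓA →ₗ[R] ΓB)) : Prop :=
  P.extended.GaugeEquivalent ξ η

end SplitPair

end Extended

/-! ## `𝒜`-ringed Lie algebroids and infinitesimal deformations -/

section Ringed

variable {𝕂 : Type*} [Field 𝕂] {R : Type*} [CommRing R] [Algebra 𝕂 R]
  {Γ : Type*} [AddCommGroup Γ] [Module 𝕂 Γ] [Module R Γ] [IsScalarTower 𝕂 R Γ]
  {Γ' : Type*} [AddCommGroup Γ'] [Module 𝕂 Γ'] [Module R Γ'] [IsScalarTower 𝕂 R Γ']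
  (𝒜 : Type*) [CommRing 𝒜] [Algebra 𝕂 𝒜]

/-- Multiplication of sections `u ∈ Γ ⊗ 𝒜` by functions `f ∈ C^∞(M_𝒜) = C^∞(M, 𝕂) ⊗ 𝒜`. -/
def fmul : 𝒜 ⊗[𝕂] R →ₗ[𝒜] 𝒜 ⊗[𝕂] Γ →ₗ[𝒜] 𝒜 ⊗[𝕂] Γ :=
  ext₂ 𝒜 (Algebra.lsmul 𝕂 𝕂 Γ : R →ₐ[𝕂] Module.End 𝕂 Γ).toLinearMap

variable (𝕂 R) in
/-- The action `⟨D, f⟩` of vector fields `D ∈ Γ(T_𝒜)` on functions `f ∈ C^∞(M_𝒜)`. -/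
def vact : 𝒜 ⊗[𝕂] Derivation 𝕂 R R →ₗ[𝒜] 𝒜 ⊗[𝕂] R →ₗ[𝒜] 𝒜 ⊗[𝕂] R :=
  ext₂ 𝒜
    { toFun := fun D => D.toLinearMap
      map_add' := fun _ _ => rfl
      map_smul' := fun _ _ => rfl }

variable (𝕂 R Γ) in
/-- A bracket and an anchor on the `𝒜`-ringed vector bundle with module of sections `Γ ⊗ 𝒜`. -/
structure RingedData where
  bracket : 𝒜 ⊗[𝕂] Γ →ₗ[𝒜] 𝒜 ⊗[𝕂] Γ →ₗ[𝒜] 𝒜 ⊗[𝕂] Γ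
  anchor : 𝒜 ⊗[𝕂] Γ →ₗ[𝒜] 𝒜 ⊗[𝕂] Derivation 𝕂 R R

variable {𝒜}

/-- The axioms of an `𝒜`-ringed Lie algebroid. -/
structure RingedData.IsLieAlgebroid (E : RingedData 𝕂 R Γ 𝒜) : Prop where
  anchor_fmul : ∀ (f : 𝒜 ⊗[𝕂] R) (u : 𝒜 ⊗[𝕂] Γ), E.anchor (fmul 𝒜 f u) = fmul 𝒜 f (E.anchor u)
  bracket_self : ∀ u, E.bracket u u = 0
  jacobi : ∀ u v w,
    E.bracket u (E.bracket v w) = E.bracket (E.bracket u v) w + E.bracket v (E.bracket u w)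
  leibniz : ∀ (u : 𝒜 ⊗[𝕂] Γ) (f : 𝒜 ⊗[𝕂] R) (v : 𝒜 ⊗[𝕂] Γ),
    E.bracket u (fmul 𝒜 f v) = fmul 𝒜 (vact 𝕂 R 𝒜 (E.anchor u) f) v + fmul 𝒜 f (E.bracket u v)

/-- The Lie algebroid `E` is the center of the `𝒜`-ringed Lie algebroid `E𝒜`. -/
def RingedData.HasCenter (ev : 𝒜 →ₐ[𝕂] 𝕂) (E𝒜 : RingedData 𝕂 R Γ 𝒜)
    (E : LieAlgebroidStr 𝕂 R Γ) : Prop :=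
  (∀ u v : Γ, evMap Γ ev (E𝒜.bracket (1 ⊗ₜ u) (1 ⊗ₜ v)) = E.bracket u v) ∧
    ∀ u : Γ, evMap (Derivation 𝕂 R R) ev (E𝒜.anchor (1 ⊗ₜ u)) = E.anchor u

variable (𝒜) in
/-- The `𝒜`-Cartesian extension of a Lie algebroid: bracket and anchor are extended
`𝒜`-linearly. -/
def LieAlgebroidStr.cartesian (E : LieAlgebroidStr 𝕂 R Γ) : RingedData 𝕂 R Γ 𝒜 where
  bracket := ext₂ 𝒜 E.bracket
  anchor := (E.anchor.restrictScalars 𝕂).baseChange 𝒜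

/-- A small automorphism `λ^*` of `M_𝒜`: an `𝒜`-algebra map lifting the identity of
`C^∞(M, 𝕂)`. -/
def IsSmall (ev : 𝒜 →ₐ[𝕂] 𝕂) (lam : 𝒜 ⊗[𝕂] R →ₐ[𝒜] 𝒜 ⊗[𝕂] R) : Prop :=
  ∀ f : R, evMap R ev (lam (1 ⊗ₜ f)) = f

/-- `(Φ, lam)` is a morphism of `𝒜`-ringed Lie algebroids from `E` to `E'` over `M_𝒜`. That the
center of `Φ` is `C^∞(M, 𝕂)`-linear, i.e. a map of vector bundles, is a consequence of
`map_fmul`. -/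
structure IsRingedHom (ev : 𝒜 →ₐ[𝕂] 𝕂) (E : RingedData 𝕂 R Γ 𝒜) (E' : RingedData 𝕂 R Γ' 𝒜)
    (Φ : 𝒜 ⊗[𝕂] Γ →ₗ[𝒜] 𝒜 ⊗[𝕂] Γ') (lam : 𝒜 ⊗[𝕂] R →ₐ[𝒜] 𝒜 ⊗[𝕂] R) : Prop where
  small : IsSmall ev lam
  map_fmul : ∀ (f : 𝒜 ⊗[𝕂] R) (u : 𝒜 ⊗[𝕂] Γ), Φ (fmul 𝒜 f u) = fmul 𝒜 (lam f) (Φ u)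
  map_bracket : ∀ u v, Φ (E.bracket u v) = E'.bracket (Φ u) (Φ v)
  map_anchor : ∀ (u : 𝒜 ⊗[𝕂] Γ) (f : 𝒜 ⊗[𝕂] R),
    lam (vact 𝕂 R 𝒜 (E.anchor u) f) = vact 𝕂 R 𝒜 (E'.anchor (Φ u)) (lam f)

/-- `(Φ, lam)` is a small automorphism of the `𝒜`-Cartesian extension of a Lie algebroid: a
morphism from it to itself whose center is the identity. -/
def LieAlgebroidStr.IsSmallAut (E : LieAlgebroidStr 𝕂 R Γ) (ev : 𝒜 →ₐ[𝕂] 𝕂)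
    (Φ : 𝒜 ⊗[𝕂] Γ →ₗ[𝒜] 𝒜 ⊗[𝕂] Γ) (lam : 𝒜 ⊗[𝕂] R →ₐ[𝒜] 𝒜 ⊗[𝕂] R) : Prop :=
  IsRingedHom ev (E.cartesian 𝒜) (E.cartesian 𝒜) Φ lam ∧ ∀ u : Γ, center ev Φ u = u

variable {ΓA : Type*} [AddCommGroup ΓA] [Module 𝕂 ΓA] [Module R ΓA] [IsScalarTower 𝕂 R ΓA]
  {ΓL : Type*} [AddCommGroup ΓL] [Module 𝕂 ΓL] [Module R ΓL] [IsScalarTower 𝕂 R ΓL]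
  {ΓB : Type*} [AddCommGroup ΓB] [Module 𝕂 ΓB] [Module R ΓB] [IsScalarTower 𝕂 R ΓB]

variable (𝕂 R 𝒜 ΓA ΓL) in
/-- The data `([-,-]_{A_𝒜}, ρ_{A_𝒜}; I, λ^*)` of an infinitesimal deformation. -/
structure DeformationData where
  str : RingedData 𝕂 R ΓA 𝒜
  I : 𝒜 ⊗[𝕂] ΓA →ₗ[𝒜] 𝒜 ⊗[𝕂] ΓL
  lam : 𝒜 ⊗[𝕂] R →ₐ[𝒜] 𝒜 ⊗[𝕂] R

variable (P : SplitPair 𝕂 R ΓA ΓL ΓB) (ev : 𝒜 →ₐ[𝕂] 𝕂)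

/-- The data `D` is an infinitesimal deformation of the Lie pair `(L, A)`. -/
structure SplitPair.IsInfinitesimalDeformation (D : DeformationData 𝕂 R 𝒜 ΓA ΓL) : Prop where
  isLieAlgebroid : D.str.IsLieAlgebroid
  hasCenter : D.str.HasCenter ev P.LA
  isHom : IsRingedHom ev D.str (P.LL.cartesian 𝒜) D.I D.lam
  center_I : ∀ a : ΓA, center ev D.I a = P.i a

/-- Two infinitesimal deformations `D = (I, λ^*)` and `D' = (I', λ'^*)` are weakly isomorphic:
there are a small automorphism `(Φ, μ)` of `L⁰_𝒜` and a morphism `(ΦA, μA)` of `𝒜`-ringed Lie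
algebroids from the source of `I'` to the source of `I` with
`(Φ, μ) ∘ (I', λ'^*) = (I, λ^*) ∘ (ΦA, μA)`. -/
def SplitPair.WeaklyIsomorphic (D D' : DeformationData 𝕂 R 𝒜 ΓA ΓL) : Prop :=
  ∃ Φ μ, P.LL.IsSmallAut ev Φ μ ∧
    ∃ ΦA μA, IsRingedHom ev D'.str D.str ΦA μA ∧
      Φ ∘ₗ D'.I = D.I ∘ₗ ΦA ∧ μ.comp D'.lam = D.lam.comp μA

/-- `ξ ∈ Γ(A* ⊗ B) ⊗ 𝒜` as an `𝒜`-linear map `Γ(A_𝒜) → Γ(B_𝒜)`. -/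
def formOp (ξ : 𝒜 ⊗[𝕂] (ΓA →ₗ[R] ΓB)) : 𝒜 ⊗[𝕂] ΓA →ₗ[𝒜] 𝒜 ⊗[𝕂] ΓB :=
  extApp 𝒜 ΓA ΓB ((LinearMap.restrictScalarsₗ 𝕂 R ΓA ΓB 𝕂).baseChange 𝒜 ξ)

/-- The map `I_ξ(a) = i(a) + j(ξ(a))`. -/
def SplitPair.graphMap (ξ : 𝒜 ⊗[𝕂] (ΓA →ₗ[R] ΓB)) : 𝒜 ⊗[𝕂] ΓA →ₗ[𝒜] 𝒜 ⊗[𝕂] ΓL :=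
  (P.i.restrictScalars 𝕂).baseChange 𝒜 + (P.j.restrictScalars 𝕂).baseChange 𝒜 ∘ₗ formOp ξ

/-- The data `([-,-]^ξ, ρ^ξ; I_ξ, id)` of the standard deformation given by `ξ`, where
`[a₁, a₂]^ξ = prA [I_ξ(a₁), I_ξ(a₂)]` and `ρ^ξ(a) = ρ_L(I_ξ(a))`. -/
def SplitPair.standard (ξ : 𝒜 ⊗[𝕂] (ΓA →ₗ[R] ΓB)) : DeformationData 𝕂 R 𝒜 ΓA ΓL where
  str :=
    { bracket := (((P.LL.cartesian 𝒜).bracket).compl₁₂ (P.graphMap ξ) (P.graphMap ξ)).compr₂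
        ((P.prA.restrictScalars 𝕂).baseChange 𝒜)
      anchor := (P.LL.cartesian 𝒜).anchor ∘ₗ P.graphMap ξ }
  I := P.graphMap ξ
  lam := AlgHom.id 𝒜 (𝒜 ⊗[𝕂] R)

end Ringed

/-! ## Smooth functions, sections and bundle maps over the field `𝕂 = ℝ` or `ℂ` -/

section Geometry

variable (𝕂 : Type*) [RCLike 𝕂]
  {E : Type*} [NormedAddCommGroup E] [NormedSpace ℝ E]
  {H : Type*} [TopologicalSpace H] (I : ModelWithCorners ℝ E H)
  (M : Type*) [TopologicalSpace M] [ChartedSpace H M]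

/-- The `𝕂`-algebra `C^∞(M, 𝕂)` of smooth `𝕂`-valued functions on `M`. -/
def SmoothFun : Subalgebra 𝕂 (M → 𝕂) where
  carrier := {f | ContMDiff I 𝓘(ℝ, 𝕂) ∞ f}
  mul_mem' hf hg :=
    (contDiff_mul (𝕜 := ℝ) (𝔸 := 𝕂)).comp_contMDiff (ContMDiff.prodMk_space hf hg)
  add_mem' hf hg := ContMDiff.add hf hg
  algebraMap_mem' _ := contMDiff_const

variable {M}
variable (F : Type*) [NormedAddCommGroup F] [NormedSpace 𝕂 F] [NormedSpace ℝ F]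
  [IsScalarTower ℝ 𝕂 F]
  (V : M → Type*) [∀ x, AddCommGroup (V x)] [∀ x, Module 𝕂 (V x)] [∀ x, Module ℝ (V x)]
  [∀ x, TopologicalSpace (V x)] [TopologicalSpace (Bundle.TotalSpace F V)]
  [FiberBundle F V] [VectorBundle 𝕂 F V] [VectorBundle ℝ F V]

/-- The module `Γ(V)` of smooth sections of a `𝕂`-vector bundle `V`, over the ring
`C^∞(M, 𝕂)` acting pointwise. Smoothness is over `ℝ`. -/
def Sections : Submodule (SmoothFun 𝕂 I M) (Π x, V x) where
  carrier := {s | ContMDiff I (I.prod 𝓘(ℝ, F)) ∞ (fun x => (⟨x, s x⟩ : Bundle.TotalSpace F V))}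
  add_mem' hs ht := ContMDiff.add_section hs ht
  zero_mem' := Bundle.contMDiff_zeroSection ℝ V
  smul_mem' := by
    intro f s hs x₀
    have h1 := hs x₀
    rw [Bundle.contMDiffAt_section] at h1 ⊢
    have h2 : ContMDiffAt I 𝓘(ℝ, 𝕂) ∞ (f : M → 𝕂) x₀ := f.2 x₀
    set e := trivializationAt F V x₀
    have h3 : ContDiff ℝ ∞ (fun p : 𝕂 × F => p.1 • p.2) :=
      (isBoundedBilinearMap_smul (𝕜 := ℝ) (A := 𝕂) (E := F)).contDiff
    refine (h3.comp_contMDiffAt (ContMDiffAt.prodMk_space h2 h1)).congr_of_eventuallyEq ?_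
    filter_upwards [e.open_baseSet.mem_nhds
      (FiberBundle.mem_baseSet_trivializationAt F V x₀)] with x hx
    exact (e.linear 𝕂 hx).2 _ _

/-- The space of sections `Γ(V)` as a type. -/
def Sec : Type _ := Sections 𝕂 I F V

instance : AddCommGroup (Sec 𝕂 I F V) := inferInstanceAs (AddCommGroup (Sections 𝕂 I F V))

instance : Module (SmoothFun 𝕂 I M) (Sec 𝕂 I F V) :=
  inferInstanceAs (Module (SmoothFun 𝕂 I M) (Sections 𝕂 I F V))

instance : Module 𝕂 (Sec 𝕂 I F V) :=
  Module.compHom (Sec 𝕂 I F V) (algebraMap 𝕂 (SmoothFun 𝕂 I M))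

instance : IsScalarTower 𝕂 (SmoothFun 𝕂 I M) (Sec 𝕂 I F V) :=
  IsScalarTower.of_algebraMap_smul (fun _ _ => rfl)

variable {V}
variable {F' : Type*} [NormedAddCommGroup F'] [NormedSpace 𝕂 F'] [NormedSpace ℝ F']
  [IsScalarTower ℝ 𝕂 F']
  {V' : M → Type*} [∀ x, AddCommGroup (V' x)] [∀ x, Module 𝕂 (V' x)] [∀ x, Module ℝ (V' x)]
  [∀ x, TopologicalSpace (V' x)] [TopologicalSpace (Bundle.TotalSpace F' V')]
  [FiberBundle F' V'] [VectorBundle 𝕂 F' V'] [VectorBundle ℝ F' V']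

variable (V V' F') in
/-- A (smooth, fibrewise `𝕂`-linear) map of vector bundles over the identity of `M`. -/
structure BundleHom where
  /-- the maps on fibres -/
  fib : ∀ x, V x →ₗ[𝕂] V' x
  smooth : ContMDiff (I.prod 𝓘(ℝ, F)) (I.prod 𝓘(ℝ, F')) ∞
    (fun p : Bundle.TotalSpace F V => (⟨p.1, fib p.1 p.2⟩ : Bundle.TotalSpace F' V'))

/-- The `C^∞(M, 𝕂)`-linear map on sections induced by a bundle map. -/
def BundleHom.onSections {𝕂 : Type*} [RCLike 𝕂] {I : ModelWithCorners ℝ E H}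
    {F : Type*} [NormedAddCommGroup F] [NormedSpace 𝕂 F] [NormedSpace ℝ F] [IsScalarTower ℝ 𝕂 F]
    {V : M → Type*} [∀ x, AddCommGroup (V x)] [∀ x, Module 𝕂 (V x)] [∀ x, Module ℝ (V x)]
    [∀ x, TopologicalSpace (V x)] [TopologicalSpace (Bundle.TotalSpace F V)]
    [FiberBundle F V] [VectorBundle 𝕂 F V] [VectorBundle ℝ F V]
    {F' : Type*} [NormedAddCommGroup F'] [NormedSpace 𝕂 F'] [NormedSpace ℝ F']
    [IsScalarTower ℝ 𝕂 F']
    {V' : M → Type*} [∀ x, AddCommGroup (V' x)] [∀ x, Module 𝕂 (V' x)] [∀ x, Module ℝ (V' x)]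
    [∀ x, TopologicalSpace (V' x)] [TopologicalSpace (Bundle.TotalSpace F' V')]
    [FiberBundle F' V'] [VectorBundle 𝕂 F' V'] [VectorBundle ℝ F' V']
    (φ : BundleHom 𝕂 I F V F' V') :
    Sec 𝕂 I F V →ₗ[SmoothFun 𝕂 I M] Sec 𝕂 I F' V' where
  toFun s := ⟨fun x => φ.fib x (s.1 x), φ.smooth.comp s.2⟩
  map_add' s t := Subtype.ext (funext fun x => map_add (φ.fib x) (s.1 x) (t.1 x))
  map_smul' f s := Subtype.ext (funext fun x => map_smul (φ.fib x) (f.1 x) (s.1 x))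

end Geometry

/-! ## Lie pairs of vector bundles -/

section GeometricPairs

variable {𝕂 : Type*} [RCLike 𝕂]
  {E : Type*} [NormedAddCommGroup E] [NormedSpace ℝ E]
  {H : Type*} [TopologicalSpace H] (I : ModelWithCorners ℝ E H)
  {M : Type*} [TopologicalSpace M] [ChartedSpace H M]
  (FA : Type*) [NormedAddCommGroup FA] [NormedSpace 𝕂 FA] [NormedSpace ℝ FA] [IsScalarTower ℝ 𝕂 FA]
  (A : M → Type*) [∀ x, AddCommGroup (A x)] [∀ x, Module 𝕂 (A x)] [∀ x, Module ℝ (A x)]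
  [∀ x, TopologicalSpace (A x)] [TopologicalSpace (Bundle.TotalSpace FA A)]
  [FiberBundle FA A] [VectorBundle 𝕂 FA A] [VectorBundle ℝ FA A]
  (FL : Type*) [NormedAddCommGroup FL] [NormedSpace 𝕂 FL] [NormedSpace ℝ FL] [IsScalarTower ℝ 𝕂 FL]
  (L : M → Type*) [∀ x, AddCommGroup (L x)] [∀ x, Module 𝕂 (L x)] [∀ x, Module ℝ (L x)]
  [∀ x, TopologicalSpace (L x)] [TopologicalSpace (Bundle.TotalSpace FL L)]
  [FiberBundle FL L] [VectorBundle 𝕂 FL L] [VectorBundle ℝ FL L]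
  (FB : Type*) [NormedAddCommGroup FB] [NormedSpace 𝕂 FB] [NormedSpace ℝ FB] [IsScalarTower ℝ 𝕂 FB]
  (B : M → Type*) [∀ x, AddCommGroup (B x)] [∀ x, Module 𝕂 (B x)] [∀ x, Module ℝ (B x)]
  [∀ x, TopologicalSpace (B x)] [TopologicalSpace (Bundle.TotalSpace FB B)]
  [FiberBundle FB B] [VectorBundle 𝕂 FB B] [VectorBundle ℝ FB B]

variable (𝕂) in
/-- A Lie pair `(L, A)` of `𝕂`-Lie algebroids over `M` together with a splitting: an injective
bundle map `i : A → L` that is a morphism of Lie algebroids, the quotient bundle `prB : L → B`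
(any model of `L / A`), and a splitting `j : B → L`, `prA : L → A` of the exact sequence
`0 → A → L → B → 0` of vector bundles. -/
structure LiePair where
  strA : LieAlgebroidStr 𝕂 (SmoothFun 𝕂 I M) (Sec 𝕂 I FA A)
  strL : LieAlgebroidStr 𝕂 (SmoothFun 𝕂 I M) (Sec 𝕂 I FL L)
  i : BundleHom 𝕂 I FA A FL L
  prB : BundleHom 𝕂 I FL L FB B
  j : BundleHom 𝕂 I FB B FL L
  prA : BundleHom 𝕂 I FL L FA A
  prB_i : ∀ x a, prB.fib x (i.fib x a) = 0
  prB_j : ∀ x b, prB.fib x (j.fib x b) = b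
  prA_i : ∀ x a, prA.fib x (i.fib x a) = a
  decomp : ∀ x l, i.fib x (prA.fib x l) + j.fib x (prB.fib x l) = l
  i_bracket : ∀ a a', i.onSections (strA.bracket a a') =
    strL.bracket (i.onSections a) (i.onSections a')
  i_anchor : ∀ a, strL.anchor (i.onSections a) = strA.anchor a

variable {I FA A FL L FB B}

/-- The Lie pair at the level of global sections. -/
def LiePair.sections (P : LiePair 𝕂 I FA A FL L FB B) :
    SplitPair 𝕂 (SmoothFun 𝕂 I M) (Sec 𝕂 I FA A) (Sec 𝕂 I FL L) (Sec 𝕂 I FB B) where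
  LA := P.strA
  LL := P.strL
  i := P.i.onSections
  prB := P.prB.onSections
  j := P.j.onSections
  prA := P.prA.onSections
  prB_i a := Subtype.ext (funext fun x => P.prB_i x (a.1 x))
  prB_j b := Subtype.ext (funext fun x => P.prB_j x (b.1 x))
  prA_i a := Subtype.ext (funext fun x => P.prA_i x (a.1 x))
  decomp l := Subtype.ext (funext fun x => P.decomp x (l.1 x))
  i_bracket := P.i_bracket
  i_anchor := P.i_anchor

end GeometricPairs

end LiePairs

end

/-! ## Idea of the proof

The small automorphisms of `L⁰_𝒜` are exactly the exponentials of the elements of `Der(L) ⊗ 𝔪`: a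
unipotent operator is the exponential of a unique nilpotent one, and an identity which says that
exponentials intertwine some map passes to their logarithms, in particular the identities which
say that an automorphism preserves the bracket, the module structure and the anchor. An element
`b = (δ, u)` of degree `0` acts on `Γ(L_𝒜)` through the derivation `Δ = δ + [j u, -]`, so that
`Γ(B)` only contributes inner derivations.

Along `exp (t Δ)` the graph of `ξ` stays the graph of a form, which solves a Riccati equation in
`t`. The brackets of `𝔥` are the coefficients of this equation and its Taylor coefficients at `0`
are the `-e^k_ξ(b)`; hence `exp Δ` maps the graph of `ξ` onto the graph of `e^b * ξ`. The
Maurer–Cartan equation says that the graph of `ξ` is closed under the bracket, so a small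
automorphism which maps one such graph onto another induces a morphism between the sources of the
standard deformations. -/

noncomputable section

namespace LiePairs

/-! ## Nilpotent exponentials and intertwiners -/

section ExpLog

variable {S : Type*} [Ring S] [Module ℚ S] {a b : S}

theorem exists_exp_eq_one_add_add_sq_mul (ha : IsNilpotent a) :
    ∃ c, (∀ y, Commute a y → Commute c y) ∧ IsNilpotent.exp a = 1 + a + a ^ 2 * c := by
  obtain ⟨k, hk⟩ := ha
  refine ⟨∑ i ∈ Finset.range k, ((i + 2).factorial : ℚ)⁻¹ • a ^ i, fun y hy => ?_, ?_⟩
  · exact Commute.sum_left _ _ _ fun i _ => (hy.pow_left i).smul_left _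
  · rw [IsNilpotent.exp_eq_sum (k := k + 2) (by rw [pow_add, hk, zero_mul]),
      Finset.sum_range_succ', Finset.sum_range_succ', Finset.mul_sum]
    simp only [mul_smul_comm, ← pow_add, add_comm 2, zero_add, Nat.factorial_zero,
      Nat.factorial_one, Nat.cast_one, inv_one, pow_zero, pow_one, one_smul]
    abel

theorem exists_exp_neg_mul_one_add_eq (ha : IsNilpotent a) :
    ∃ d, (∀ y, Commute a y → Commute d y) ∧
      IsNilpotent.exp (-a) * (1 + a) = 1 + a ^ 2 * d := by
  obtain ⟨c, hc, hexp⟩ := exists_exp_eq_one_add_add_sq_mul ha.neg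
  refine ⟨c - 1 + a * c, fun y hy => ?_, ?_⟩
  · exact ((hc y hy.neg_left).sub_left (Commute.one_left y)).add_left
      (hy.mul_left (hc y hy.neg_left))
  · have hca : a ^ 2 * c * a = a ^ 2 * (a * c) := by
      rw [mul_assoc, (hc a (Commute.neg_left rfl)).eq]
    rw [hexp, neg_sq, mul_add, mul_one, add_mul, hca]
    noncomm_ring

-- Newton's method: `exp (-a) * (1 + a)` differs from `1` only to second order in `a`.
theorem exists_exp_mul_eq_one_add (ha : IsNilpotent a) :
    ∃ c, (∀ y, Commute a y → Commute c y) ∧ IsNilpotent.exp (a * c) = 1 + a := by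
  suffices H : ∀ (k : ℕ) (a : S), a ^ 2 ^ k = 0 →
      ∃ c, (∀ y, Commute a y → Commute c y) ∧ IsNilpotent.exp (a * c) = 1 + a by
    obtain ⟨k, hk⟩ := ha
    exact H k a (pow_eq_zero_of_le Nat.lt_two_pow_self.le hk)
  intro k
  induction k with
  | zero =>
    rintro a hk
    obtain rfl : a = 0 := by simpa using hk
    exact ⟨0, fun y _ => Commute.zero_left y, by simp⟩
  | succ k ih =>
    intro a hk
    have ha : IsNilpotent a := ⟨_, hk⟩
    obtain ⟨d, hd, hexp⟩ := exists_exp_neg_mul_one_add_eq ha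
    have hcomm : ∀ y, Commute a y → Commute (a ^ 2 * d) y := fun y hy =>
      (hy.pow_left 2).mul_left (hd y hy)
    have hsq : (a ^ 2 * d) ^ 2 ^ k = 0 := by
      rw [((hd a rfl).symm.pow_left 2).mul_pow, ← pow_mul, ← pow_succ', hk, zero_mul]
    obtain ⟨c, hc, hexpc⟩ := ih _ hsq
    refine ⟨1 + a * d * c, fun y hy => ?_, ?_⟩
    · exact (Commute.one_left y).add_left
        ((hy.mul_left (hd y hy)).mul_left (hc y (hcomm y hy)))
    · have hac : Commute a (a ^ 2 * d * c) :=
        (hcomm a rfl).symm.mul_right (hc a (hcomm a rfl)).symm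
      have hnil : IsNilpotent (a ^ 2 * d * c) :=
        (hc _ (Commute.refl _)).symm.isNilpotent_mul_right ⟨_, hsq⟩
      rw [show a * (1 + a * d * c) = a + a ^ 2 * d * c by noncomm_ring,
        IsNilpotent.exp_add_of_commute hac ha hnil, hexpc, ← hexp, ← mul_assoc,
        IsNilpotent.exp_mul_exp_neg_self ha, one_mul]

theorem eq_zero_of_exp_eq_one (ha : IsNilpotent a) (h : IsNilpotent.exp a = 1) : a = 0 := by
  obtain ⟨c, hc, hexp⟩ := exists_exp_eq_one_add_add_sq_mul ha
  have hunit : IsUnit (1 + a * c) := ((hc a rfl).symm.isNilpotent_mul_right ha).isUnit_one_add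
  refine hunit.mul_left_eq_zero.1 ?_
  rw [h, add_assoc, left_eq_add] at hexp
  rw [← hexp]
  noncomm_ring

theorem exp_injective_of_commute (hab : Commute a b) (ha : IsNilpotent a) (hb : IsNilpotent b)
    (h : IsNilpotent.exp a = IsNilpotent.exp b) : a = b := by
  refine sub_eq_zero.1 (eq_zero_of_exp_eq_one (hab.isNilpotent_sub ha hb) ?_)
  rw [sub_eq_add_neg, IsNilpotent.exp_add_of_commute hab.neg_right ha hb.neg, h,
    IsNilpotent.exp_mul_exp_neg_self hb]

theorem commute_of_commute_exp (ha : IsNilpotent a) (h : Commute (IsNilpotent.exp a) b) :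
    Commute a b := by
  obtain ⟨c, hc, hexp⟩ := exists_exp_mul_eq_one_add (IsNilpotent.isNilpotent_exp_sub_one ha)
  set e := IsNilpotent.exp a - 1
  have hlog : ∀ y, Commute e y → Commute (e * c) y := fun y hy => hy.mul_left (hc y hy)
  have hea : Commute e a := by
    obtain ⟨d, hd, hexpa⟩ := exists_exp_eq_one_add_add_sq_mul ha
    rw [show e = a + a ^ 2 * d by simp only [e, hexpa]; abel]
    exact (Commute.refl a).add_left (((Commute.refl a).pow_left 2).mul_left (hd a rfl))
  have hnil : IsNilpotent (e * c) :=
    (hc e rfl).symm.isNilpotent_mul_right (IsNilpotent.isNilpotent_exp_sub_one ha)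
  have hlog_eq : e * c = a :=
    exp_injective_of_commute (hlog a hea) hnil ha (hexp.trans (add_sub_cancel _ _))
  exact hlog_eq ▸ hlog b (h.sub_left (Commute.one_left b))

end ExpLog

section Intertwiners

variable {𝒜 : Type*} [CommRing 𝒜] {X Y Z : Type*} [AddCommGroup X] [Module 𝒜 X] [Module ℚ X]
  [AddCommGroup Y] [Module 𝒜 Y] [Module ℚ Y] [AddCommGroup Z] [Module 𝒜 Z] [Module ℚ Z]

theorem isNilpotent_prodMk {A B : Type*} [MonoidWithZero A] [MonoidWithZero B] {a : A} {b : B}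
    (ha : IsNilpotent a) (hb : IsNilpotent b) : IsNilpotent (a, b) := by
  obtain ⟨k, hk⟩ := ha
  obtain ⟨l, hl⟩ := hb
  exact ⟨max k l, Prod.ext (pow_eq_zero_of_le (le_max_left k l) hk)
    (pow_eq_zero_of_le (le_max_right k l) hl)⟩

theorem exp_prodMap {f : Module.End 𝒜 X} {g : Module.End 𝒜 Y} (hf : IsNilpotent f)
    (hg : IsNilpotent g) :
    IsNilpotent.exp (f.prodMap g : Module.End 𝒜 (X × Y)) =
      (IsNilpotent.exp f).prodMap (IsNilpotent.exp g) := by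
  have hfg := isNilpotent_prodMk hf hg
  calc IsNilpotent.exp (LinearMap.prodMapRingHom 𝒜 X Y (f, g))
      = LinearMap.prodMapRingHom 𝒜 X Y (IsNilpotent.exp (f, g)) := (hfg.map_exp _).symm
    _ = _ := congrArg₂ LinearMap.prodMap (hfg.map_exp (RingHom.fst _ _))
        (hfg.map_exp (RingHom.snd _ _))

-- Apply `commute_of_commute_exp` to the block matrices `diag(f, g)` and `(0, 0; h, 0)`.
theorem comp_eq_comp_of_exp_comp_eq {f : Module.End 𝒜 X} {g : Module.End 𝒜 Y} {h : X →ₗ[𝒜] Y}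
    (hf : IsNilpotent f) (hg : IsNilpotent g)
    (H : IsNilpotent.exp g ∘ₗ h = h ∘ₗ IsNilpotent.exp f) : g ∘ₗ h = h ∘ₗ f := by
  let N : Module.End 𝒜 (X × Y) := f.prodMap g
  let T : Module.End 𝒜 (X × Y) := LinearMap.inr 𝒜 X Y ∘ₗ h ∘ₗ LinearMap.fst 𝒜 X Y
  have hN : IsNilpotent N := (isNilpotent_prodMk hf hg).map (LinearMap.prodMapRingHom 𝒜 X Y)
  have hcomm : Commute (IsNilpotent.exp N) T := by
    rw [exp_prodMap hf hg]
    refine LinearMap.ext fun v => Prod.ext ?_ ?_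
    · simp [T]
    · simpa [T] using LinearMap.congr_fun H v.1
  ext x
  simpa [N, T] using congrArg Prod.snd
    (LinearMap.congr_fun (commute_of_commute_exp hN hcomm) (x, 0))

theorem exp_comp_eq_iff {f : Module.End 𝒜 X} {g : Module.End 𝒜 Y} {h : X →ₗ[𝒜] Y}
    (hf : IsNilpotent f) (hg : IsNilpotent g) :
    IsNilpotent.exp g ∘ₗ h = h ∘ₗ IsNilpotent.exp f ↔ g ∘ₗ h = h ∘ₗ f :=
  ⟨comp_eq_comp_of_exp_comp_eq hf hg, Module.End.commute_exp_left_of_commute hf hg⟩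

/-- The Leibniz rule for three endomorphisms with respect to a bilinear map `β`. All the axioms of
a derivation of a Lie algebroid are instances of it. -/
def IsLeibniz (β : X →ₗ[𝒜] Y →ₗ[𝒜] Z) (f : Module.End 𝒜 X) (g : Module.End 𝒜 Y)
    (h : Module.End 𝒜 Z) : Prop :=
  ∀ x y, h (β x y) = β (f x) y + β x (g y)

theorem exp_apply_bilinear_iff_isLeibniz (β : X →ₗ[𝒜] Y →ₗ[𝒜] Z) {f : Module.End 𝒜 X}
    {g : Module.End 𝒜 Y} {h : Module.End 𝒜 Z}
    (hf : IsNilpotent f) (hg : IsNilpotent g) (hh : IsNilpotent h) :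
    (∀ x y, IsNilpotent.exp h (β x y) = β (IsNilpotent.exp f x) (IsNilpotent.exp g y)) ↔
      IsLeibniz β f g h := by
  let F : Module.End 𝒜 (X ⊗[𝒜] Y) := f.rTensor Y
  let G : Module.End 𝒜 (X ⊗[𝒜] Y) := g.lTensor X
  have hF : IsNilpotent F := hf.map (Module.End.rTensorAlgHom 𝒜 X Y)
  have hG : IsNilpotent G := hg.map (Module.End.lTensorAlgHom 𝒜 Y X)
  have hcomm : Commute F G := by ext; simp [F, G]
  have hexp : IsNilpotent.exp (F + G) =
      (IsNilpotent.exp f).rTensor Y * (IsNilpotent.exp g).lTensor X := by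
    rw [IsNilpotent.exp_add_of_commute hcomm hF hG]
    exact congrArg₂ (· * ·) (hf.map_exp (Module.End.rTensorAlgHom 𝒜 X Y)).symm
      (hg.map_exp (Module.End.lTensorAlgHom 𝒜 Y X)).symm
  have hintertwine := exp_comp_eq_iff (h := TensorProduct.lift β) (hcomm.isNilpotent_add hF hG) hh
  rw [hexp] at hintertwine
  refine Iff.trans ?_ (hintertwine.trans ?_)
  · refine ⟨fun H => TensorProduct.ext' fun x y => by simpa using H x y, fun H x y => ?_⟩
    simpa using LinearMap.congr_fun H (x ⊗ₜ y)
  · refine ⟨fun H x y => ?_, fun H => TensorProduct.ext' fun x y => by simpa [F, G] using H x y⟩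
    simpa [F, G] using LinearMap.congr_fun H (x ⊗ₜ y)

end Intertwiners

/-! ## A Riccati equation for formal exponentials -/

section Riccati

open Polynomial Finset

variable {S : Type*} [Ring S] [Module ℚ S]

theorem eq_zero_of_derivative_eq_mul_self {G H : S[X]} (h : derivative G = H * G)
    (h0 : G.coeff 0 = 0) : G = 0 := by
  ext n
  induction n using Nat.strong_induction_on with
  | _ n ih =>
    rcases n with _ | n
    · simpa using h0
    · have hsum : ∑ ij ∈ antidiagonal n, H.coeff ij.1 * G.coeff ij.2 = 0 :=
        sum_eq_zero fun ij hij => by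
          have hle := HasAntidiagonal.mem_antidiagonal.1 hij
          rw [ih ij.2 (by omega), coeff_zero, mul_zero]
      have hcoeff : ((n + 1 : ℕ) : ℚ) • G.coeff (n + 1) = 0 := by
        rw [← hsum, ← coeff_mul, ← h, coeff_derivative, Nat.cast_smul_eq_nsmul, nsmul_eq_mul,
          Nat.cast_comm, Nat.cast_succ]
      simpa using (smul_eq_zero_iff_right (by positivity)).1 hcoeff

theorem riccati_linearization {p q D w : S} {x y : S[X]} (hpq : p + q = 1)
    (hx : derivative x = (C q - x) * C D * (C p + x)) (hy : derivative y = C D * y)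
    (h0 : ((C q - x) * y * C w).coeff 0 = 0) : (C q - x) * y * C w = 0 := by
  refine eq_zero_of_derivative_eq_mul_self (H := (C q - x) * C D) ?_ h0
  have hp : C p = 1 - C q := by rw [← C_1, ← C_sub, ← hpq, add_sub_cancel_right]
  rw [derivative_mul, derivative_mul, derivative_sub, derivative_C, derivative_C, hx, hy, hp]
  noncomm_ring

/-- The polynomial `∑ c n tⁿ / n!` of a sequence `c` that vanishes from `N` on. -/
def expGenPoly (c : ℕ → S) (N : ℕ) : S[X] :=
  ∑ n ∈ range N, monomial n ((n.factorial : ℚ)⁻¹ • c n)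

theorem eval_one_expGenPoly (c : ℕ → S) (N : ℕ) :
    (expGenPoly c N).eval 1 = ∑ n ∈ range N, (n.factorial : ℚ)⁻¹ • c n := by
  simp [expGenPoly, eval_finsetSum]

variable {c c' : ℕ → S} {N N' : ℕ}

theorem coeff_expGenPoly (hc : ∀ n, N ≤ n → c n = 0) (n : ℕ) :
    (expGenPoly c N).coeff n = (n.factorial : ℚ)⁻¹ • c n := by
  simp only [expGenPoly, finsetSum_coeff, coeff_monomial, sum_ite_eq', mem_range]
  split_ifs with hn
  · rfl
  · rw [hc n (not_lt.1 hn), smul_zero]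

theorem coeff_derivative_expGenPoly (hc : ∀ n, N ≤ n → c n = 0) (n : ℕ) :
    (derivative (expGenPoly c N)).coeff n = (n.factorial : ℚ)⁻¹ • c (n + 1) := by
  rw [coeff_derivative, coeff_expGenPoly hc, ← Nat.cast_succ, ← Nat.cast_comm, ← nsmul_eq_mul,
    ← Nat.cast_smul_eq_nsmul ℚ, smul_smul, Nat.factorial_succ, Nat.cast_mul]
  field_simp

theorem coeff_expGenPoly_mul_C_mul_expGenPoly (hc : ∀ n, N ≤ n → c n = 0)
    (hc' : ∀ n, N' ≤ n → c' n = 0) (D : S) (n : ℕ) :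
    (expGenPoly c N * C D * expGenPoly c' N').coeff n = (n.factorial : ℚ)⁻¹ •
      ∑ ij ∈ antidiagonal n, (n.choose ij.1 : ℚ) • (c ij.1 * D * c' ij.2) := by
  rw [coeff_mul, smul_sum]
  refine sum_congr rfl fun ij hij => ?_
  obtain rfl := HasAntidiagonal.mem_antidiagonal.1 hij
  rw [coeff_mul_C, coeff_expGenPoly hc, coeff_expGenPoly hc', smul_mul_assoc, smul_mul_assoc,
    mul_smul_comm, smul_smul, smul_smul, Nat.choose_symm_add, Nat.add_choose,
    Nat.cast_div (Nat.factorial_mul_factorial_dvd_factorial_add _ _) (by positivity)]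
  push_cast
  field_simp

theorem derivative_expGenPoly_pow {D : S} (hD : D ^ N = 0) :
    derivative (expGenPoly (D ^ ·) N) = C D * expGenPoly (D ^ ·) N := by
  have hpow : ∀ n, N ≤ n → D ^ n = 0 := fun n hn => pow_eq_zero_of_le hn hD
  ext n
  rw [coeff_derivative_expGenPoly hpow, coeff_C_mul, coeff_expGenPoly hpow, pow_succ',
    mul_smul_comm]

theorem derivative_expGenPoly_of_riccati {p q D : S} (hc : ∀ n, N ≤ n → c n = 0)
    (hc1 : c 1 = (q - c 0) * D * (p + c 0))
    (hrec : ∀ n, c (n + 2) = q * D * c (n + 1) - c (n + 1) * D * p -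
      ∑ ij ∈ antidiagonal (n + 1), ((n + 1).choose ij.1 : ℚ) • (c ij.1 * D * c ij.2)) :
    derivative (expGenPoly c N) =
      (C q - expGenPoly c N) * C D * (C p + expGenPoly c N) := by
  set x := expGenPoly c N with hx
  have hexpand : (C q - x) * C D * (C p + x) =
      C (q * D * p) + C (q * D) * x - x * C (D * p) - x * C D * x := by
    simp only [C_mul]
    noncomm_ring
  ext n
  rw [hexpand, coeff_sub, coeff_sub, coeff_add, hx, coeff_derivative_expGenPoly hc,
    coeff_expGenPoly_mul_C_mul_expGenPoly hc hc, coeff_C_mul, coeff_mul_C, coeff_expGenPoly hc]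
  rcases n with _ | n
  · simp only [zero_add, hc1, Nat.factorial_zero, Nat.cast_one, inv_one, one_smul, coeff_C_zero,
      HasAntidiagonal.antidiagonal_zero, sum_singleton, Nat.choose_self]
    noncomm_ring
  · rw [hrec, coeff_C_of_ne_zero n.succ_ne_zero, zero_add, smul_sub, smul_sub, mul_smul_comm,
      smul_mul_assoc, mul_assoc (c (n + 1))]

theorem riccati_exp_mul_eq {p q D : S} (hpq : p + q = 1) (hqp : q * p = 0)
    (hqc : ∀ n, q * c n = c n) (hcp : ∀ n, c n * p = c n) (hD : IsNilpotent D)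
    (hc : ∀ n, N ≤ n → c n = 0) (hc1 : c 1 = (q - c 0) * D * (p + c 0))
    (hrec : ∀ n, c (n + 2) = q * D * c (n + 1) - c (n + 1) * D * p -
      ∑ ij ∈ antidiagonal (n + 1), ((n + 1).choose ij.1 : ℚ) • (c ij.1 * D * c ij.2)) :
    (∑ n ∈ range N, (n.factorial : ℚ)⁻¹ • c n) * IsNilpotent.exp D * (p + c 0) =
      q * IsNilpotent.exp D * (p + c 0) := by
  obtain ⟨k, hk⟩ := hD
  have hcc : c 0 * c 0 = 0 := by
    have hcq : c 0 * q = 0 := by rw [eq_sub_of_add_eq' hpq, mul_sub, hcp, mul_one, sub_self]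
    rw [← hqc 0, ← mul_assoc, mul_assoc q, hcq, mul_zero, zero_mul]
  have hzero : (C q - expGenPoly c N) * expGenPoly (D ^ ·) k * C (p + c 0) = 0 := by
    refine riccati_linearization hpq (derivative_expGenPoly_of_riccati hc hc1 hrec)
      (derivative_expGenPoly_pow hk) ?_
    simp only [mul_coeff_zero, coeff_sub, coeff_C_zero, coeff_expGenPoly hc,
      coeff_expGenPoly fun _ hn => pow_eq_zero_of_le hn hk, pow_zero, Nat.factorial_zero,
      Nat.cast_one, inv_one, one_smul, mul_one, sub_mul, mul_add, hqp, hqc, hcp, hcc, zero_add,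
      add_zero, sub_self]
  let evalOne : S[X] →+* S := eval₂RingHom' (RingHom.id S) 1 fun a => Commute.one_right a
  have hevalOne : ∀ f, evalOne f = f.eval 1 := fun f => rfl
  have h1 := congrArg evalOne hzero
  rw [map_mul, map_mul, map_sub, map_zero] at h1
  simp only [hevalOne, eval_C, eval_one_expGenPoly, ← IsNilpotent.exp_eq_sum hk] at h1
  rw [sub_mul, sub_mul, sub_eq_zero] at h1
  exact h1.symm

end Riccati

/-! ## Extension of scalars to a local Artinian algebra -/

section FiltrationByIdeals

variable {𝒜 : Type*} [CommRing 𝒜] {I J : Ideal 𝒜} {X Y Z : Type*} [AddCommGroup X] [Module 𝒜 X]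
  [AddCommGroup Y] [Module 𝒜 Y] [AddCommGroup Z] [Module 𝒜 Z]

theorem bilinear_mem_mul_smul_top (β : X →ₗ[𝒜] Y →ₗ[𝒜] Z) {x : X} {y : Y}
    (hx : x ∈ I • (⊤ : Submodule 𝒜 X)) (hy : y ∈ J • (⊤ : Submodule 𝒜 Y)) :
    β x y ∈ (I * J) • (⊤ : Submodule 𝒜 Z) := by
  have hrange : LinearMap.range (β x) ≤ I • (⊤ : Submodule 𝒜 Z) := by
    rintro _ ⟨y', rfl⟩
    exact Submodule.smul_top_le_comap_smul_top I (β.flip y') hx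
  have hmem := Submodule.mem_map_of_mem (f := β x) hy
  rw [Submodule.map_smul'', Submodule.map_top] at hmem
  rw [mul_comm, Submodule.mul_smul]
  exact Submodule.smul_mono le_rfl hrange hmem

theorem isNilpotent_of_forall_mem_smul_top (hI : IsNilpotent I) {Φ : Module.End 𝒜 X}
    (hΦ : ∀ x, Φ x ∈ I • (⊤ : Submodule 𝒜 X)) : IsNilpotent Φ := by
  have hrange : LinearMap.range Φ ≤ I • ⊤ := by
    rintro _ ⟨x, rfl⟩
    exact hΦ x
  have hpow : ∀ n, LinearMap.range (Φ ^ n) ≤ I ^ n • ⊤ := fun n => by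
    induction n with
    | zero => simp
    | succ n ih =>
      rw [pow_succ', Module.End.mul_eq_comp, LinearMap.range_comp]
      refine (Submodule.map_mono ih).trans ?_
      rw [Submodule.map_smul'', Submodule.map_top, pow_succ, Submodule.mul_smul]
      exact Submodule.smul_mono le_rfl hrange
  obtain ⟨n, hn⟩ := hI
  refine ⟨n, LinearMap.range_eq_bot.1 (le_bot_iff.1 ((hpow n).trans_eq ?_))⟩
  rw [hn, Submodule.zero_eq_bot, Submodule.bot_smul]

end FiltrationByIdeals

section ExtensionOfScalars

variable {𝕂 : Type*} [Field 𝕂] {𝒜 : Type*} [CommRing 𝒜] [Algebra 𝕂 𝒜]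
  {X Y Z D : Type*} [AddCommGroup X] [Module 𝕂 X] [AddCommGroup Y] [Module 𝕂 Y]
  [AddCommGroup Z] [Module 𝕂 Z] [AddCommGroup D] [Module 𝕂 D]

@[elab_as_elim]
theorem extension_induction {p : 𝒜 ⊗[𝕂] X → Prop} (t : 𝒜 ⊗[𝕂] X)
    (one_tmul : ∀ x, p (1 ⊗ₜ x)) (add : ∀ s t, p s → p t → p (s + t))
    (smul : ∀ (a : 𝒜) t, p t → p (a • t)) : p t := by
  induction t with
  | zero => simpa using one_tmul 0
  | add s t hs ht => exact add s t hs ht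
  | tmul a x => simpa [TensorProduct.smul_tmul'] using smul a _ (one_tmul x)

@[simp]
theorem extApp_tmul (a b : 𝒜) (φ : X →ₗ[𝕂] Y) (x : X) :
    extApp 𝒜 X Y (a ⊗ₜ φ) (b ⊗ₜ x) = (a * b) ⊗ₜ φ x := by
  simp [extApp, TensorProduct.smul_tmul']

theorem ext₂_one_tmul (β : X →ₗ[𝕂] Y →ₗ[𝕂] Z) (x : X) (y : Y) :
    ext₂ 𝒜 β (1 ⊗ₜ x) (1 ⊗ₜ y) = 1 ⊗ₜ β x y := by
  rw [ext₂_tmul, one_mul]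

theorem ext₂_comp (β : Y →ₗ[𝕂] Z →ₗ[𝕂] D) (f : X →ₗ[𝕂] Y) :
    ext₂ 𝒜 (β ∘ₗ f) = ext₂ 𝒜 β ∘ₗ f.baseChange 𝒜 := by
  rw [ext₂, LinearMap.baseChange_comp, ← LinearMap.comp_assoc, ext₂]

theorem ext₂_mul {R : Type*} [CommRing R] [Algebra 𝕂 R] :
    ext₂ 𝒜 (LinearMap.mul 𝕂 R) = LinearMap.mul 𝒜 (𝒜 ⊗[𝕂] R) := by
  ext f g
  simp [ext₂_tmul]

theorem isLeibniz_ext₂ {β : X →ₗ[𝕂] Y →ₗ[𝕂] Z} {F : D →ₗ[𝕂] Module.End 𝕂 X}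
    {G : D →ₗ[𝕂] Module.End 𝕂 Y} {H : D →ₗ[𝕂] Module.End 𝕂 Z}
    (h : ∀ δ, IsLeibniz β (F δ) (G δ) (H δ)) (t : 𝒜 ⊗[𝕂] D) :
    IsLeibniz (ext₂ 𝒜 β) (ext₂ 𝒜 F t) (ext₂ 𝒜 G t) (ext₂ 𝒜 H t) := by
  intro x y
  induction t using extension_induction with
  | add s t hs ht => simp only [map_add, LinearMap.add_apply, hs, ht]; abel
  | smul a t ht => simp only [map_smul, LinearMap.smul_apply, ht, smul_add]
  | one_tmul δ =>
    induction x using extension_induction with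
    | add x x' hx hx' => simp only [map_add, LinearMap.add_apply, hx, hx']; abel
    | smul a x hx => simp only [map_smul, LinearMap.smul_apply, hx, smul_add]
    | one_tmul x =>
      induction y using extension_induction with
      | add y y' hy hy' => simp only [map_add, hy, hy']; abel
      | smul a y hy => simp only [map_smul, hy, smul_add]
      | one_tmul y => simp only [ext₂_one_tmul, h δ x y, TensorProduct.tmul_add]

section Coordinates

variable (φ : 𝒜 →ₗ[𝕂] 𝕂)

variable (X) in
/-- The map `φ ⊗ id : 𝒜 ⊗ X → X` given by a linear functional `φ` on `𝒜`. -/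
def coordMap : 𝒜 ⊗[𝕂] X →ₗ[𝕂] X :=
  (TensorProduct.lid 𝕂 X).toLinearMap ∘ₗ φ.rTensor X

@[simp]
theorem coordMap_tmul (a : 𝒜) (x : X) : coordMap X φ (a ⊗ₜ x) = φ a • x := by
  simp [coordMap]

theorem coordMap_ext₂_left (β : X →ₗ[𝕂] Y →ₗ[𝕂] Z) (t : 𝒜 ⊗[𝕂] X) (y : Y) :
    coordMap Z φ (ext₂ 𝒜 β t (1 ⊗ₜ y)) = β (coordMap X φ t) y := by
  induction t with
  | zero => simp
  | add s t hs ht => simp only [map_add, LinearMap.add_apply, hs, ht]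
  | tmul a x => simp [ext₂_tmul]

theorem coordMap_ext₂_right (β : X →ₗ[𝕂] Y →ₗ[𝕂] Z) (x : X) (t : 𝒜 ⊗[𝕂] Y) :
    coordMap Z φ (ext₂ 𝒜 β (1 ⊗ₜ x) t) = β x (coordMap Y φ t) := by
  induction t with
  | zero => simp
  | add s t hs ht => simp only [map_add, hs, ht]
  | tmul a x => simp [ext₂_tmul]

theorem eq_of_coordMap_eq {s t : 𝒜 ⊗[𝕂] X} (h : ∀ φ, coordMap X φ s = coordMap X φ t) : s = t := by
  let b := Module.Free.chooseBasis 𝕂 𝒜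
  refine (TensorProduct.equivFinsuppOfBasisLeft b).injective (Finsupp.ext fun i => ?_)
  rw [TensorProduct.equivFinsuppOfBasisLeft_apply, TensorProduct.equivFinsuppOfBasisLeft_apply]
  exact h (b.coord i)

theorem sum_tmul_coordMap {ι : Type*} [Fintype ι] (b : Module.Basis ι 𝕂 𝒜) (t : 𝒜 ⊗[𝕂] X) :
    ∑ i, b i ⊗ₜ[𝕂] coordMap X (b.coord i) t = t := by
  induction t with
  | zero => simp
  | add s t hs ht => simp only [map_add, TensorProduct.tmul_add, Finset.sum_add_distrib, hs, ht]
  | tmul a x =>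
    simp only [coordMap_tmul, TensorProduct.tmul_smul, TensorProduct.smul_tmul',
      ← TensorProduct.sum_tmul, Module.Basis.coord_apply, b.sum_repr]

/-- The component `x ↦ (φ ⊗ id) (Φ (1 ⊗ x))` of an endomorphism of `𝒜 ⊗ X`. -/
def coordEnd (Φ : Module.End 𝒜 (𝒜 ⊗[𝕂] X)) : Module.End 𝕂 X :=
  coordMap X φ ∘ₗ Φ.restrictScalars 𝕂 ∘ₗ TensorProduct.mk 𝕂 𝒜 X 1

theorem coordEnd_apply (Φ : Module.End 𝒜 (𝒜 ⊗[𝕂] X)) (x : X) :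
    coordEnd φ Φ x = coordMap X φ (Φ (1 ⊗ₜ x)) :=
  rfl

variable {φ} in
theorem IsLeibniz.coordEnd {β : X →ₗ[𝕂] Y →ₗ[𝕂] Z} {F : Module.End 𝒜 (𝒜 ⊗[𝕂] X)}
    {G : Module.End 𝒜 (𝒜 ⊗[𝕂] Y)} {H : Module.End 𝒜 (𝒜 ⊗[𝕂] Z)}
    (h : IsLeibniz (ext₂ 𝒜 β) F G H) :
    IsLeibniz β (coordEnd φ F) (coordEnd φ G) (coordEnd φ H) := fun x y => by
  simp only [coordEnd_apply, ← coordMap_ext₂_left, ← coordMap_ext₂_right, ← map_add]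
  rw [← h, ext₂_one_tmul]

theorem ext₂_sum_tmul_eq {ι : Type*} [Fintype ι] (b : Module.Basis ι 𝕂 𝒜)
    {F : D →ₗ[𝕂] Module.End 𝕂 X} {Φ : Module.End 𝒜 (𝒜 ⊗[𝕂] X)} {δ : ι → D}
    (hδ : ∀ i, F (δ i) = LiePairs.coordEnd (b.coord i) Φ) :
    ext₂ 𝒜 F (∑ i, b i ⊗ₜ δ i) = Φ := by
  ext x
  change ext₂ 𝒜 F _ (1 ⊗ₜ x) = Φ (1 ⊗ₜ x)
  rw [map_sum, LinearMap.sum_apply, ← sum_tmul_coordMap b (Φ (1 ⊗ₜ x))]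
  exact Finset.sum_congr rfl fun i _ => by rw [ext₂_tmul, mul_one, hδ, coordEnd_apply]

end Coordinates

section Center

variable (ev : 𝒜 →ₐ[𝕂] 𝕂)

@[simp]
theorem evMap_tmul (a : 𝒜) (x : X) : evMap X ev (a ⊗ₜ x) = ev a • x :=
  coordMap_tmul _ a x

theorem evMap_smul (a : 𝒜) (t : 𝒜 ⊗[𝕂] X) : evMap X ev (a • t) = ev a • evMap X ev t := by
  induction t with
  | zero => simp
  | add s t hs ht => simp only [smul_add, map_add, hs, ht]
  | tmul b x => simp [TensorProduct.smul_tmul', mul_smul]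

theorem evMap_ext₂ (β : X →ₗ[𝕂] Y →ₗ[𝕂] Z) (s : 𝒜 ⊗[𝕂] X) (t : 𝒜 ⊗[𝕂] Y) :
    evMap Z ev (ext₂ 𝒜 β s t) = β (evMap X ev s) (evMap Y ev t) := by
  induction s using extension_induction with
  | one_tmul x => exact (coordMap_ext₂_right _ β x t).trans (by simp [evMap, coordMap])
  | add s s' hs hs' => simp only [map_add, LinearMap.add_apply, hs, hs']
  | smul a s hs => simp only [map_smul, LinearMap.smul_apply, evMap_smul, hs]

theorem center_ext₂ (F : D →ₗ[𝕂] Module.End 𝕂 X) (t : 𝒜 ⊗[𝕂] D) (x : X) :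
    center ev (ext₂ 𝒜 F t) x = F (evMap D ev t) x := by
  rw [center, evMap_ext₂, evMap_tmul, map_one, one_smul]

theorem center_sub_one (Φ : Module.End 𝒜 (𝒜 ⊗[𝕂] X)) (x : X) :
    center ev (Φ - 1) x = center ev Φ x - x := by
  simp [center]

theorem evMap_baseChange (f : X →ₗ[𝕂] Y) (t : 𝒜 ⊗[𝕂] X) :
    evMap Y ev (f.baseChange 𝒜 t) = f (evMap X ev t) := by
  induction t with
  | zero => simp
  | add s t hs ht => simp only [map_add, hs, ht]
  | tmul a x => simp

variable [IsLocalRing 𝒜]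

theorem ker_eq_maximalIdeal : RingHom.ker ev = IsLocalRing.maximalIdeal 𝒜 :=
  IsLocalRing.ker_eq_maximalIdeal (ev : 𝒜 →+* 𝕂) fun c => ⟨algebraMap 𝕂 𝒜 c, by simp⟩

theorem sub_one_tmul_evMap_mem_mPart (t : 𝒜 ⊗[𝕂] X) : t - 1 ⊗ₜ evMap X ev t ∈ mPart 𝕂 𝒜 X := by
  induction t using extension_induction with
  | one_tmul x => simp
  | add s t hs ht =>
    rw [map_add, TensorProduct.tmul_add, add_sub_add_comm]
    exact add_mem hs ht
  | smul a t ht =>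
    have ha : a - algebraMap 𝕂 𝒜 (ev a) ∈ IsLocalRing.maximalIdeal 𝒜 := by
      rw [← ker_eq_maximalIdeal ev, RingHom.mem_ker]
      simp
    have hsplit : a • t - 1 ⊗ₜ evMap X ev (a • t) = a • (t - 1 ⊗ₜ evMap X ev t) +
        (a - algebraMap 𝕂 𝒜 (ev a)) • (1 : 𝒜) ⊗ₜ[𝕂] evMap X ev t := by
      rw [evMap_smul, TensorProduct.tmul_smul]
      module
    rw [hsplit]
    exact add_mem (Submodule.smul_mem _ a ht) (Submodule.smul_mem_smul ha trivial)

theorem mem_mPart_iff {t : 𝒜 ⊗[𝕂] X} : t ∈ mPart 𝕂 𝒜 X ↔ evMap X ev t = 0 := by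
  refine ⟨fun h => ?_, fun h => by simpa [h] using sub_one_tmul_evMap_mem_mPart ev t⟩
  refine Submodule.smul_induction_on h (fun a ha t _ => ?_) fun s t hs ht => ?_
  · rw [← ker_eq_maximalIdeal ev, RingHom.mem_ker] at ha
    rw [evMap_smul, ha, zero_smul]
  · rw [map_add, hs, ht, add_zero]

theorem evMap_apply (Φ : 𝒜 ⊗[𝕂] X →ₗ[𝒜] 𝒜 ⊗[𝕂] Y) (t : 𝒜 ⊗[𝕂] X) :
    evMap Y ev (Φ t) = center ev Φ (evMap X ev t) := by
  have h := Submodule.smul_top_le_comap_smul_top _ Φ (sub_one_tmul_evMap_mem_mPart ev t)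
  rwa [Submodule.mem_comap, ← mPart, mem_mPart_iff ev, map_sub, map_sub, sub_eq_zero] at h

variable {ev} [IsArtinianRing 𝒜]

theorem isNilpotent_of_center_eq_zero {Φ : Module.End 𝒜 (𝒜 ⊗[𝕂] X)}
    (h : ∀ x, center ev Φ x = 0) : IsNilpotent Φ :=
  isNilpotent_of_forall_mem_smul_top
    ((isArtinianRing_iff_isNilpotent_maximalIdeal 𝒜).1 inferInstance)
    fun t => (mem_mPart_iff ev).2 ((evMap_apply ev Φ t).trans (h _))

theorem center_exp [Module ℚ (𝒜 ⊗[𝕂] X)] {Φ : Module.End 𝒜 (𝒜 ⊗[𝕂] X)}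
    (h : ∀ x, center ev Φ x = 0) (x : X) : center ev (IsNilpotent.exp Φ) x = x := by
  obtain ⟨c, -, hc⟩ :=
    exists_exp_eq_one_add_add_sq_mul (S := Module.End 𝒜 (𝒜 ⊗[𝕂] X))
      (isNilpotent_of_center_eq_zero h)
  have h0 : ∀ t, evMap X ev (Φ t) = 0 := fun t => (evMap_apply ev Φ t).trans (h _)
  simp [center, hc, sq, h0]

theorem isUnit_of_center_eq_self {Φ : Module.End 𝒜 (𝒜 ⊗[𝕂] X)} (h : ∀ x, center ev Φ x = x) :
    IsUnit Φ := by
  have hnil : IsNilpotent (Φ - 1) :=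
    isNilpotent_of_center_eq_zero fun x => by rw [center_sub_one, h, sub_self]
  have hadd : Φ - 1 + 1 = Φ := sub_add_cancel Φ 1
  exact hadd ▸ IsNilpotent.isUnit_add_one (R := Module.End 𝒜 (𝒜 ⊗[𝕂] X)) hnil

theorem exists_exp_eq_of_center_eq_self [Module ℚ (𝒜 ⊗[𝕂] X)] {Φ : Module.End 𝒜 (𝒜 ⊗[𝕂] X)}
    (h : ∀ x, center ev Φ x = x) :
    ∃ Δ : Module.End 𝒜 (𝒜 ⊗[𝕂] X), (∀ x, center ev Δ x = 0) ∧ IsNilpotent.exp Δ = Φ := by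
  have h1 : ∀ x, center ev (Φ - 1) x = 0 := fun x => by rw [center_sub_one, h, sub_self]
  obtain ⟨c, -, hc⟩ :=
    exists_exp_mul_eq_one_add (S := Module.End 𝒜 (𝒜 ⊗[𝕂] X)) (isNilpotent_of_center_eq_zero h1)
  have hcenter : ∀ x, center ev ((Φ - 1) * c) x = 0 := fun x =>
    (evMap_apply ev (Φ - 1) (c (1 ⊗ₜ x))).trans (h1 _)
  exact ⟨(Φ - 1) * c, hcenter, by rw [hc]; exact add_sub_cancel 1 Φ⟩

end Center

theorem finite_of_isArtinianRing [IsLocalRing 𝒜] [IsArtinianRing 𝒜] (ev : 𝒜 →ₐ[𝕂] 𝕂) :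
    Module.Finite 𝕂 𝒜 := by
  have hker : RingHom.ker ev = nilradical 𝒜 :=
    (ker_eq_maximalIdeal ev).trans (Ring.KrullDimLE.nilradical_eq_maximalIdeal 𝒜).symm
  have hfg : (RingHom.ker ev).FG := IsNoetherian.noetherian _
  exact Module.finite_of_surjective_of_ker_le_nilradical ev
    (fun c => ⟨algebraMap 𝕂 𝒜 c, by simp⟩) hker.le hfg

end ExtensionOfScalars

/-! ## Small automorphisms as exponentials of derivations -/

section CartesianExtension

variable {𝕂 : Type*} [Field 𝕂] {R : Type*} [CommRing R] [Algebra 𝕂 R]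
  {Γ : Type*} [AddCommGroup Γ] [Module 𝕂 Γ] [Module R Γ] [IsScalarTower 𝕂 R Γ]
  {𝒜 : Type*} [CommRing 𝒜] [Algebra 𝕂 𝒜]

theorem fmul_one_tmul (f : R) (u : Γ) :
    fmul 𝒜 ((1 : 𝒜) ⊗ₜ[𝕂] f) ((1 : 𝒜) ⊗ₜ[𝕂] u) = 1 ⊗ₜ (f • u) :=
  ext₂_one_tmul _ f u

theorem baseChange_fmul {Γ' : Type*} [AddCommGroup Γ'] [Module 𝕂 Γ'] [Module R Γ']
    [IsScalarTower 𝕂 R Γ'] (φ : Γ →ₗ[R] Γ') (f : 𝒜 ⊗[𝕂] R) (u : 𝒜 ⊗[𝕂] Γ) :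
    (φ.restrictScalars 𝕂).baseChange 𝒜 (fmul 𝒜 f u) =
      fmul 𝒜 f ((φ.restrictScalars 𝕂).baseChange 𝒜 u) := by
  induction f using extension_induction with
  | add f g hf hg => simp only [map_add, LinearMap.add_apply, hf, hg]
  | smul a f hf => simp only [map_smul, LinearMap.smul_apply, hf]
  | one_tmul f =>
    induction u using extension_induction with
    | add u v hu hv => simp only [map_add, hu, hv]
    | smul a u hu => simp only [map_smul, hu]
    | one_tmul u => simp [fmul_one_tmul]

variable (𝕂 R) in
/-- The action of vector fields on functions, as a linear map; its extension of scalars is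
`vact`. -/
def vectorFieldOp : Derivation 𝕂 R R →ₗ[𝕂] Module.End 𝕂 R where
  toFun D := D.toLinearMap
  map_add' _ _ := rfl
  map_smul' _ _ := rfl

variable (E : LieAlgebroidStr 𝕂 R Γ)

namespace LieAlgebroidStr

/-- The action `⟨ρ(u), f⟩` of sections on functions through the anchor. -/
def anchorOp : Γ →ₗ[𝕂] Module.End 𝕂 R :=
  vectorFieldOp 𝕂 R ∘ₗ E.anchor.restrictScalars 𝕂

/-- The operator on sections underlying a derivation. -/
def derOp : E.Der →ₗ[𝕂] Module.End 𝕂 Γ :=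
  LinearMap.fst 𝕂 _ _ ∘ₗ E.Der.subtype

/-- The action on functions of the symbol of a derivation. -/
def derSymb : E.Der →ₗ[𝕂] Module.End 𝕂 R :=
  vectorFieldOp 𝕂 R ∘ₗ LinearMap.snd 𝕂 _ _ ∘ₗ E.Der.subtype

/-- The inner derivation `[u, -]`. -/
def ad : Γ →ₗ[𝕂] E.Der where
  toFun u := ⟨(E.bracket u, E.anchor u), fun f v => E.leibniz u v f,
    fun v => (E.anchor_bracket u v).symm, E.jacobi u⟩
  map_add' u v := Subtype.ext (Prod.ext (map_add E.bracket u v) (map_add E.anchor u v))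
  map_smul' c u := Subtype.ext
    (Prod.ext (map_smul E.bracket c u) (LinearMap.map_smul_of_tower E.anchor c u))

theorem mem_Der_iff {δ : Module.End 𝕂 Γ × Derivation 𝕂 R R} :
    δ ∈ E.Der ↔
      IsLeibniz (Algebra.lsmul 𝕂 𝕂 Γ).toLinearMap (vectorFieldOp 𝕂 R δ.2) δ.1 δ.1 ∧
      IsLeibniz E.anchorOp δ.1 (vectorFieldOp 𝕂 R δ.2) (vectorFieldOp 𝕂 R δ.2) ∧
      IsLeibniz E.bracket δ.1 δ.1 δ.1 := by
  refine and_congr_right' (and_congr_left' (forall_congr' fun u => ?_))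
  rw [Derivation.ext_iff]
  refine forall_congr' fun f => ?_
  rw [Derivation.commutator_apply, sub_eq_iff_eq_add]
  rfl

theorem cartesian_bracket : (E.cartesian 𝒜).bracket = ext₂ 𝒜 E.bracket :=
  rfl

theorem vact_comp_cartesian_anchor :
    vact 𝕂 R 𝒜 ∘ₗ (E.cartesian 𝒜).anchor = ext₂ 𝒜 E.anchorOp :=
  (ext₂_comp _ _).symm

/-- The pair `(Δ, σ)` of an operator on sections and an operator on functions is a derivation of
the `𝒜`-Cartesian extension of `E`. -/
structure IsCartesianDer (Δ : Module.End 𝒜 (𝒜 ⊗[𝕂] Γ)) (σ : Module.End 𝒜 (𝒜 ⊗[𝕂] R)) :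
    Prop where
  mul : IsLeibniz (LinearMap.mul 𝒜 (𝒜 ⊗[𝕂] R)) σ σ σ
  fmul : IsLeibniz (fmul 𝒜) σ Δ Δ
  anchor : IsLeibniz (vact 𝕂 R 𝒜 ∘ₗ (E.cartesian 𝒜).anchor) Δ σ σ
  bracket : IsLeibniz (E.cartesian 𝒜).bracket Δ Δ Δ

theorem isLeibniz_mul_vectorFieldOp (D : Derivation 𝕂 R R) :
    IsLeibniz (LinearMap.mul 𝕂 R) (vectorFieldOp 𝕂 R D) (vectorFieldOp 𝕂 R D)
      (vectorFieldOp 𝕂 R D) := fun f g =>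
  (D.leibniz f g).trans (by rw [add_comm, smul_eq_mul, smul_eq_mul, mul_comm g]; rfl)

theorem isCartesianDer_ext₂ (D : 𝒜 ⊗[𝕂] E.Der) :
    E.IsCartesianDer (ext₂ 𝒜 E.derOp D) (ext₂ 𝒜 E.derSymb D) where
  mul := by
    rw [← ext₂_mul]
    exact isLeibniz_ext₂ (fun δ => isLeibniz_mul_vectorFieldOp δ.1.2) D
  fmul := isLeibniz_ext₂ (fun δ => (E.mem_Der_iff.1 δ.2).1) D
  anchor := by
    rw [vact_comp_cartesian_anchor]
    exact isLeibniz_ext₂ (fun δ => (E.mem_Der_iff.1 δ.2).2.1) D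
  bracket := isLeibniz_ext₂ (fun δ => (E.mem_Der_iff.1 δ.2).2.2) D

variable {E} in
theorem IsCartesianDer.exists_ext₂_eq [Module.Finite 𝕂 𝒜] {Δ : Module.End 𝒜 (𝒜 ⊗[𝕂] Γ)}
    {σ : Module.End 𝒜 (𝒜 ⊗[𝕂] R)} (h : E.IsCartesianDer Δ σ) :
    ∃ D : 𝒜 ⊗[𝕂] E.Der, ext₂ 𝒜 E.derOp D = Δ ∧ ext₂ 𝒜 E.derSymb D = σ := by
  let b := Module.finBasis 𝕂 𝒜
  have hmul (φ : 𝒜 →ₗ[𝕂] 𝕂) : IsLeibniz (LinearMap.mul 𝕂 R) (coordEnd φ σ) (coordEnd φ σ)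
      (coordEnd φ σ) := by
    have := h.mul
    rw [← ext₂_mul] at this
    exact this.coordEnd
  let symb (φ : 𝒜 →ₗ[𝕂] 𝕂) : Derivation 𝕂 R R := Derivation.mk' (coordEnd φ σ) fun f g =>
    (hmul φ f g).trans (by rw [add_comm, smul_eq_mul, smul_eq_mul, mul_comm g]; rfl)
  have hmem (φ : 𝒜 →ₗ[𝕂] 𝕂) : (coordEnd φ Δ, symb φ) ∈ E.Der := by
    have hanchor := h.anchor
    rw [vact_comp_cartesian_anchor] at hanchor
    exact E.mem_Der_iff.2
      ⟨IsLeibniz.coordEnd h.fmul, hanchor.coordEnd, IsLeibniz.coordEnd h.bracket⟩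
  exact ⟨∑ i, b i ⊗ₜ ⟨_, hmem (b.coord i)⟩, ext₂_sum_tmul_eq b fun i => rfl,
    ext₂_sum_tmul_eq b fun i => rfl⟩

theorem cartesian_skew (u v : 𝒜 ⊗[𝕂] Γ) :
    (E.cartesian 𝒜).bracket u v = -(E.cartesian 𝒜).bracket v u := by
  rw [E.cartesian_bracket]
  induction u using extension_induction with
  | add u u' h h' => simp only [map_add, LinearMap.add_apply, h, h', neg_add]
  | smul a u h => simp only [map_smul, LinearMap.smul_apply, h, smul_neg]
  | one_tmul u =>
    induction v using extension_induction with
    | add v v' h h' => simp only [map_add, LinearMap.add_apply, h, h', neg_add]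
    | smul a v h => simp only [map_smul, LinearMap.smul_apply, h, smul_neg]
    | one_tmul v => rw [ext₂_one_tmul, ext₂_one_tmul, E.skew, TensorProduct.tmul_neg]

theorem cartesian_isLieAlgebroid : (E.cartesian 𝒜).IsLieAlgebroid where
  anchor_fmul := baseChange_fmul E.anchor
  bracket_self u := by
    induction u using extension_induction with
    | one_tmul u => rw [cartesian_bracket, ext₂_one_tmul, E.bracket_self, TensorProduct.tmul_zero]
    | smul a u h => simp only [map_smul, LinearMap.smul_apply, h, smul_zero]
    | add u v hu hv =>
      simp only [map_add, LinearMap.add_apply, hu, hv, E.cartesian_skew u v]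
      abel
  jacobi := isLeibniz_ext₂ E.jacobi
  leibniz u f v := by
    have h := isLeibniz_ext₂ (β := (Algebra.lsmul 𝕂 𝕂 Γ).toLinearMap) (F := E.anchorOp)
      (fun u f v => E.leibniz u v f) u f v
    rwa [← vact_comp_cartesian_anchor] at h

end LieAlgebroidStr

end CartesianExtension

section SmallAutomorphisms

variable {𝕂 : Type*} [Field 𝕂] {R : Type*} [CommRing R] [Algebra 𝕂 R]
  {Γ : Type*} [AddCommGroup Γ] [Module 𝕂 Γ] [Module R Γ] [IsScalarTower 𝕂 R Γ]
  {𝒜 : Type*} [CommRing 𝒜] [Algebra 𝕂 𝒜] [IsLocalRing 𝒜] [IsArtinianRing 𝒜]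
  [Module ℚ (𝒜 ⊗[𝕂] Γ)] [Module ℚ (𝒜 ⊗[𝕂] R)] {E : LieAlgebroidStr 𝕂 R Γ} {ev : 𝒜 →ₐ[𝕂] 𝕂}

namespace LieAlgebroidStr

theorem IsCartesianDer.exists_isSmallAut_exp {Δ : Module.End 𝒜 (𝒜 ⊗[𝕂] Γ)}
    {σ : Module.End 𝒜 (𝒜 ⊗[𝕂] R)} (h : E.IsCartesianDer Δ σ) (hΔ : ∀ u, center ev Δ u = 0)
    (hσ : ∀ f, center ev σ f = 0) : ∃ μ, E.IsSmallAut ev (IsNilpotent.exp Δ) μ := by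
  have nΔ := isNilpotent_of_center_eq_zero hΔ
  have nσ := isNilpotent_of_center_eq_zero hσ
  have hmul := (exp_apply_bilinear_iff_isLeibniz _ nσ nσ nσ).2 h.mul
  have hone : IsNilpotent.exp σ 1 = 1 := by
    have hinv : IsNilpotent.exp σ (IsNilpotent.exp (-σ) 1) = 1 := by
      rw [← Module.End.mul_apply, IsNilpotent.exp_mul_exp_neg_self nσ, Module.End.one_apply]
    simpa [hinv] using (hmul 1 (IsNilpotent.exp (-σ) 1)).symm
  refine ⟨AlgHom.ofLinearMap (IsNilpotent.exp σ) hone hmul, ?_, center_exp hΔ⟩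
  exact
    { small := center_exp hσ
      map_fmul := (exp_apply_bilinear_iff_isLeibniz _ nσ nΔ nΔ).2 h.fmul
      map_bracket := (exp_apply_bilinear_iff_isLeibniz _ nΔ nΔ nΔ).2 h.bracket
      map_anchor := (exp_apply_bilinear_iff_isLeibniz _ nΔ nσ nσ).2 h.anchor }

theorem IsSmallAut.exists_isCartesianDer {Φ : Module.End 𝒜 (𝒜 ⊗[𝕂] Γ)}
    {μ : 𝒜 ⊗[𝕂] R →ₐ[𝒜] 𝒜 ⊗[𝕂] R} (h : E.IsSmallAut ev Φ μ) :
    ∃ Δ σ, E.IsCartesianDer Δ σ ∧ (∀ u, center ev Δ u = 0) ∧ (∀ f, center ev σ f = 0) ∧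
      IsNilpotent.exp Δ = Φ := by
  obtain ⟨⟨hsmall, hfmul, hbracket, hanchor⟩, hcenter⟩ := h
  obtain ⟨Δ, hΔ, rfl⟩ := exists_exp_eq_of_center_eq_self hcenter
  obtain ⟨σ, hσ, hexp⟩ := exists_exp_eq_of_center_eq_self (Φ := μ.toLinearMap) hsmall
  have nΔ := isNilpotent_of_center_eq_zero hΔ
  have nσ := isNilpotent_of_center_eq_zero hσ
  have hμ : ∀ f, μ f = IsNilpotent.exp σ f := fun f => (LinearMap.congr_fun hexp f).symm
  simp only [hμ] at hfmul hanchor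
  refine ⟨Δ, σ, ⟨?_, ?_, ?_, ?_⟩, hΔ, hσ, rfl⟩
  · refine (exp_apply_bilinear_iff_isLeibniz _ nσ nσ nσ).1 fun f g => ?_
    rw [← hμ, ← hμ, ← hμ]
    exact map_mul μ f g
  · exact (exp_apply_bilinear_iff_isLeibniz _ nσ nΔ nΔ).1 hfmul
  · exact (exp_apply_bilinear_iff_isLeibniz _ nΔ nσ nσ).1 hanchor
  · exact (exp_apply_bilinear_iff_isLeibniz _ nΔ nΔ nΔ).1 hbracket

theorem exists_isSmallAut_iff {Φ : Module.End 𝒜 (𝒜 ⊗[𝕂] Γ)} :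
    (∃ μ, E.IsSmallAut ev Φ μ) ↔
      ∃ D ∈ mPart 𝕂 𝒜 E.Der, IsNilpotent.exp (ext₂ 𝒜 E.derOp D) = Φ := by
  constructor
  · rintro ⟨μ, h⟩
    obtain ⟨Δ, σ, hder, hΔ, hσ, rfl⟩ := h.exists_isCartesianDer
    have := finite_of_isArtinianRing ev
    obtain ⟨D, rfl, rfl⟩ := hder.exists_ext₂_eq
    refine ⟨D, (mem_mPart_iff ev).2 (Subtype.ext (Prod.ext ?_ ?_)), rfl⟩
    · exact LinearMap.ext fun u => (center_ext₂ ev E.derOp D u).symm.trans (hΔ u)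
    · exact Derivation.ext fun f => (center_ext₂ ev E.derSymb D f).symm.trans (hσ f)
  · rintro ⟨D, hD, rfl⟩
    rw [mem_mPart_iff ev] at hD
    exact (E.isCartesianDer_ext₂ D).exists_isSmallAut_exp
      (fun u => by rw [center_ext₂, hD, map_zero, LinearMap.zero_apply])
      (fun f => by rw [center_ext₂, hD, map_zero, LinearMap.zero_apply])

end LieAlgebroidStr

end SmallAutomorphisms

/-! ## Standard deformations -/

section StandardDeformations

variable {𝕂 : Type*} [Field 𝕂] {R : Type*} [CommRing R] [Algebra 𝕂 R]
  {ΓA : Type*} [AddCommGroup ΓA] [Module 𝕂 ΓA] [Module R ΓA] [IsScalarTower 𝕂 R ΓA]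
  {ΓL : Type*} [AddCommGroup ΓL] [Module 𝕂 ΓL] [Module R ΓL] [IsScalarTower 𝕂 R ΓL]
  {ΓB : Type*} [AddCommGroup ΓB] [Module 𝕂 ΓB] [Module R ΓB] [IsScalarTower 𝕂 R ΓB]
  {𝒜 : Type*} [CommRing 𝒜] [Algebra 𝕂 𝒜]

theorem ext₂_one_tmul_left {X Y Z : Type*} [AddCommGroup X] [Module 𝕂 X] [AddCommGroup Y]
    [Module 𝕂 Y] [AddCommGroup Z] [Module 𝕂 Z] (β : X →ₗ[𝕂] Y →ₗ[𝕂] Z) (x : X) :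
    ext₂ 𝒜 β (1 ⊗ₜ x) = (β x).baseChange 𝒜 := by
  ext y
  simp [ext₂_tmul]

theorem formOp_eq_ext₂ (ξ : 𝒜 ⊗[𝕂] (ΓA →ₗ[R] ΓB)) :
    formOp ξ = ext₂ 𝒜 (LinearMap.restrictScalarsₗ 𝕂 R ΓA ΓB 𝕂) ξ :=
  rfl

theorem formOp_fmul (ξ : 𝒜 ⊗[𝕂] (ΓA →ₗ[R] ΓB)) (f : 𝒜 ⊗[𝕂] R) (a : 𝒜 ⊗[𝕂] ΓA) :
    formOp ξ (fmul 𝒜 f a) = fmul 𝒜 f (formOp ξ a) := by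
  rw [formOp_eq_ext₂]
  induction ξ using extension_induction with
  | add ξ η hξ hη => simp only [map_add, LinearMap.add_apply, hξ, hη]
  | smul r ξ hξ => simp only [map_smul, LinearMap.smul_apply, hξ]
  | one_tmul X =>
    rw [ext₂_one_tmul_left]
    exact baseChange_fmul X f a

theorem formOp_injective :
    Function.Injective (formOp : 𝒜 ⊗[𝕂] (ΓA →ₗ[R] ΓB) → 𝒜 ⊗[𝕂] ΓA →ₗ[𝒜] 𝒜 ⊗[𝕂] ΓB) := by
  intro ξ η h
  refine eq_of_coordMap_eq fun φ => LinearMap.ext fun a => ?_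
  have hφ := congrArg (coordMap ΓB φ) (LinearMap.congr_fun h (1 ⊗ₜ a))
  rwa [formOp_eq_ext₂, formOp_eq_ext₂, coordMap_ext₂_left, coordMap_ext₂_left] at hφ

/-- An element of `Ω²_A(B) ⊗ 𝒜` as an `𝒜`-bilinear map `Γ(A_𝒜) × Γ(A_𝒜) → Γ(B_𝒜)`. -/
def twoFormOp : 𝒜 ⊗[𝕂] (ΓA →ₗ[𝕂] ΓA →ₗ[𝕂] ΓB) →ₗ[𝒜]
    𝒜 ⊗[𝕂] ΓA →ₗ[𝒜] 𝒜 ⊗[𝕂] ΓA →ₗ[𝒜] 𝒜 ⊗[𝕂] ΓB :=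
  LinearMap.compRight 𝒜 (extApp 𝒜 ΓA ΓB) ∘ₗ extApp 𝒜 ΓA (ΓA →ₗ[𝕂] ΓB)

theorem twoFormOp_one_tmul (θ : ΓA →ₗ[𝕂] ΓA →ₗ[𝕂] ΓB) (a b : ΓA) :
    twoFormOp ((1 : 𝒜) ⊗ₜ[𝕂] θ) (1 ⊗ₜ a) (1 ⊗ₜ b) = 1 ⊗ₜ θ a b := by
  simp [twoFormOp]

variable (P : SplitPair 𝕂 R ΓA ΓL ΓB)

namespace SplitPair

variable (𝒜) in
/-- The extension `Γ(A_𝒜) → Γ(L_𝒜)` of `i`. -/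
abbrev extI : 𝒜 ⊗[𝕂] ΓA →ₗ[𝒜] 𝒜 ⊗[𝕂] ΓL :=
  (P.i.restrictScalars 𝕂).baseChange 𝒜

variable (𝒜) in
/-- The extension `Γ(B_𝒜) → Γ(L_𝒜)` of `j`. -/
abbrev extJ : 𝒜 ⊗[𝕂] ΓB →ₗ[𝒜] 𝒜 ⊗[𝕂] ΓL :=
  (P.j.restrictScalars 𝕂).baseChange 𝒜

variable (𝒜) in
/-- The extension `Γ(L_𝒜) → Γ(A_𝒜)` of `prA`. -/
abbrev extPrA : 𝒜 ⊗[𝕂] ΓL →ₗ[𝒜] 𝒜 ⊗[𝕂] ΓA :=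
  (P.prA.restrictScalars 𝕂).baseChange 𝒜

variable (𝒜) in
/-- The extension `Γ(L_𝒜) → Γ(B_𝒜)` of `prB`. -/
abbrev extPrB : 𝒜 ⊗[𝕂] ΓL →ₗ[𝒜] 𝒜 ⊗[𝕂] ΓB :=
  (P.prB.restrictScalars 𝕂).baseChange 𝒜

omit [Module 𝕂 ΓB] [IsScalarTower 𝕂 R ΓB] in
theorem extPrA_extI (a : 𝒜 ⊗[𝕂] ΓA) : P.extPrA 𝒜 (P.extI 𝒜 a) = a := by
  induction a with
  | zero => simp
  | add a b ha hb => simp only [map_add, ha, hb]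
  | tmul r a => simp [P.prA_i]

omit [IsScalarTower 𝕂 R ΓA] in
theorem extPrB_extJ (b : 𝒜 ⊗[𝕂] ΓB) : P.extPrB 𝒜 (P.extJ 𝒜 b) = b := by
  induction b with
  | zero => simp
  | add a b ha hb => simp only [map_add, ha, hb]
  | tmul r b => simp [P.prB_j]

theorem extPrB_extI (a : 𝒜 ⊗[𝕂] ΓA) : P.extPrB 𝒜 (P.extI 𝒜 a) = 0 := by
  induction a with
  | zero => simp
  | add a b ha hb => simp only [map_add, ha, hb, add_zero]
  | tmul r a => simp [P.prB_i]

theorem extPrA_extJ (b : 𝒜 ⊗[𝕂] ΓB) : P.extPrA 𝒜 (P.extJ 𝒜 b) = 0 := by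
  induction b with
  | zero => simp
  | add a b ha hb => simp only [map_add, ha, hb, add_zero]
  | tmul r b => simp [P.prA_j]

theorem extI_extPrA_add_extJ_extPrB (l : 𝒜 ⊗[𝕂] ΓL) :
    P.extI 𝒜 (P.extPrA 𝒜 l) + P.extJ 𝒜 (P.extPrB 𝒜 l) = l := by
  induction l with
  | zero => simp
  | add l m hl hm => rw [map_add, map_add, map_add, map_add, add_add_add_comm, hl, hm]
  | tmul r l => simp [← TensorProduct.tmul_add, P.decomp]

omit [Module 𝕂 ΓB] [IsScalarTower 𝕂 R ΓB] in
theorem extI_bracket (a b : 𝒜 ⊗[𝕂] ΓA) :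
    P.extI 𝒜 (ext₂ 𝒜 P.LA.bracket a b) = ext₂ 𝒜 P.LL.bracket (P.extI 𝒜 a) (P.extI 𝒜 b) := by
  induction a using extension_induction with
  | add a a' h h' => simp only [map_add, LinearMap.add_apply, h, h']
  | smul r a h => simp only [map_smul, LinearMap.smul_apply, h]
  | one_tmul a =>
    induction b using extension_induction with
    | add b b' h h' => simp only [map_add, h, h']
    | smul r b h => simp only [map_smul, h]
    | one_tmul b => simp [ext₂_tmul, P.i_bracket]

section Graph

variable (ξ : 𝒜 ⊗[𝕂] (ΓA →ₗ[R] ΓB)) (a : 𝒜 ⊗[𝕂] ΓA)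

theorem graphMap_apply : P.graphMap ξ a = P.extI 𝒜 a + P.extJ 𝒜 (formOp ξ a) :=
  rfl

theorem extPrA_graphMap : P.extPrA 𝒜 (P.graphMap ξ a) = a := by
  rw [graphMap_apply, map_add, extPrA_extI, extPrA_extJ, add_zero]

theorem extPrB_graphMap : P.extPrB 𝒜 (P.graphMap ξ a) = formOp ξ a := by
  rw [graphMap_apply, map_add, extPrB_extI, extPrB_extJ, zero_add]

theorem graphMap_injective :
    Function.Injective (P.graphMap : 𝒜 ⊗[𝕂] (ΓA →ₗ[R] ΓB) → _) := by
  intro ξ η h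
  refine formOp_injective (LinearMap.ext fun a => ?_)
  rw [← P.extPrB_graphMap, h, extPrB_graphMap]

theorem graphMap_fmul (f : 𝒜 ⊗[𝕂] R) :
    P.graphMap ξ (fmul 𝒜 f a) = fmul 𝒜 f (P.graphMap ξ a) := by
  rw [graphMap_apply, graphMap_apply, formOp_fmul, map_add, extI, extJ, baseChange_fmul,
    baseChange_fmul]

variable {ξ} in
theorem evMap_graphMap [IsLocalRing 𝒜] (ev : 𝒜 →ₐ[𝕂] 𝕂) (hξ : ξ ∈ mPart 𝕂 𝒜 (ΓA →ₗ[R] ΓB)) :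
    evMap ΓL ev (P.graphMap ξ a) = P.i (evMap ΓA ev a) := by
  rw [graphMap_apply, map_add, evMap_baseChange, evMap_baseChange, formOp_eq_ext₂, evMap_ext₂,
    (mem_mPart_iff ev).1 hξ]
  simp

end Graph

section MaurerCartan

variable (X Y Z : 𝒜 ⊗[𝕂] (ΓA →ₗ[R] ΓB)) (a b : 𝒜 ⊗[𝕂] ΓA)

theorem twoFormOp_formD :
    twoFormOp (P.formD.baseChange 𝒜 X) a b =
      P.extPrB 𝒜 (ext₂ 𝒜 P.LL.bracket (P.extI 𝒜 a) (P.extJ 𝒜 (formOp X b)))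
        - P.extPrB 𝒜 (ext₂ 𝒜 P.LL.bracket (P.extI 𝒜 b) (P.extJ 𝒜 (formOp X a)))
        - formOp X (ext₂ 𝒜 P.LA.bracket a b) := by
  rw [formOp_eq_ext₂]
  induction X using extension_induction with
  | add X X' h h' => simp only [map_add, LinearMap.add_apply, h, h']; abel
  | smul r X h => simp only [map_smul, LinearMap.smul_apply, h, smul_sub]
  | one_tmul X =>
    induction a using extension_induction with
    | add a a' h h' => simp only [map_add, LinearMap.add_apply, h, h']; abel
    | smul r a h => simp only [map_smul, LinearMap.smul_apply, h, smul_sub]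
    | one_tmul a =>
      induction b using extension_induction with
      | add b b' h h' => simp only [map_add, LinearMap.add_apply, h, h']; abel
      | smul r b h => simp only [map_smul, LinearMap.smul_apply, h, smul_sub]
      | one_tmul b =>
        simp only [LinearMap.baseChange_tmul, ext₂_one_tmul, twoFormOp_one_tmul,
          ← TensorProduct.tmul_sub]
        rfl

theorem twoFormOp_formBr₂ :
    twoFormOp (ext₂ 𝒜 P.formBr₂ X Y) a b =
      P.extPrB 𝒜 (ext₂ 𝒜 P.LL.bracket (P.extJ 𝒜 (formOp X a)) (P.extJ 𝒜 (formOp Y b)))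
        - formOp X (P.extPrA 𝒜 (ext₂ 𝒜 P.LL.bracket (P.extJ 𝒜 (formOp Y a)) (P.extI 𝒜 b)))
        - formOp X (P.extPrA 𝒜 (ext₂ 𝒜 P.LL.bracket (P.extI 𝒜 a) (P.extJ 𝒜 (formOp Y b))))
      + (P.extPrB 𝒜 (ext₂ 𝒜 P.LL.bracket (P.extJ 𝒜 (formOp Y a)) (P.extJ 𝒜 (formOp X b)))
        - formOp Y (P.extPrA 𝒜 (ext₂ 𝒜 P.LL.bracket (P.extJ 𝒜 (formOp X a)) (P.extI 𝒜 b)))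
        - formOp Y (P.extPrA 𝒜 (ext₂ 𝒜 P.LL.bracket (P.extI 𝒜 a) (P.extJ 𝒜 (formOp X b))))) := by
  rw [formOp_eq_ext₂, formOp_eq_ext₂]
  induction X using extension_induction with
  | add X X' h h' => simp only [map_add, LinearMap.add_apply, h, h']; abel
  | smul r X h => simp only [map_smul, LinearMap.smul_apply, h, smul_sub, smul_add]
  | one_tmul X =>
    induction Y using extension_induction with
    | add Y Y' h h' => simp only [map_add, LinearMap.add_apply, h, h']; abel
    | smul r Y h => simp only [map_smul, LinearMap.smul_apply, h, smul_sub, smul_add]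
    | one_tmul Y =>
      induction a using extension_induction with
      | add a a' h h' => simp only [map_add, LinearMap.add_apply, h, h']; abel
      | smul r a h => simp only [map_smul, LinearMap.smul_apply, h, smul_sub, smul_add]
      | one_tmul a =>
        induction b using extension_induction with
        | add b b' h h' => simp only [map_add, h, h']; abel
        | smul r b h => simp only [map_smul, h, smul_sub, smul_add]
        | one_tmul b =>
          simp only [LinearMap.baseChange_tmul, ext₂_one_tmul, twoFormOp_one_tmul,
            ← TensorProduct.tmul_sub, ← TensorProduct.tmul_add]
          rfl

theorem twoFormOp_formBr₃ :
    twoFormOp (ext₃ 𝒜 P.formBr₃ X Y Z) a b =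
      -formOp X (P.extPrA 𝒜 (ext₂ 𝒜 P.LL.bracket (P.extJ 𝒜 (formOp Y a)) (P.extJ 𝒜 (formOp Z b))))
        - formOp X (P.extPrA 𝒜
            (ext₂ 𝒜 P.LL.bracket (P.extJ 𝒜 (formOp Z a)) (P.extJ 𝒜 (formOp Y b))))
      + (-formOp Y (P.extPrA 𝒜
            (ext₂ 𝒜 P.LL.bracket (P.extJ 𝒜 (formOp X a)) (P.extJ 𝒜 (formOp Z b))))
        - formOp Y (P.extPrA 𝒜
            (ext₂ 𝒜 P.LL.bracket (P.extJ 𝒜 (formOp Z a)) (P.extJ 𝒜 (formOp X b)))))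
      + (-formOp Z (P.extPrA 𝒜
            (ext₂ 𝒜 P.LL.bracket (P.extJ 𝒜 (formOp X a)) (P.extJ 𝒜 (formOp Y b))))
        - formOp Z (P.extPrA 𝒜
            (ext₂ 𝒜 P.LL.bracket (P.extJ 𝒜 (formOp Y a)) (P.extJ 𝒜 (formOp X b))))) := by
  rw [formOp_eq_ext₂, formOp_eq_ext₂, formOp_eq_ext₂, ext₃]
  induction X using extension_induction with
  | add X X' h h' => simp only [map_add, LinearMap.add_apply, h, h']; abel
  | smul r X h => simp only [map_smul, LinearMap.smul_apply, h, smul_sub, smul_add, smul_neg]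
  | one_tmul X =>
    induction Y using extension_induction with
    | add Y Y' h h' => simp only [map_add, LinearMap.add_apply, h, h']; abel
    | smul r Y h => simp only [map_smul, LinearMap.smul_apply, h, smul_sub, smul_add, smul_neg]
    | one_tmul Y =>
      induction Z using extension_induction with
      | add Z Z' h h' => simp only [map_add, LinearMap.add_apply, h, h']; abel
      | smul r Z h => simp only [map_smul, LinearMap.smul_apply, h, smul_sub, smul_add, smul_neg]
      | one_tmul Z =>
        induction a using extension_induction with
        | add a a' h h' => simp only [map_add, LinearMap.add_apply, h, h']; abel
        | smul r a h => simp only [map_smul, LinearMap.smul_apply, h, smul_sub, smul_add, smul_neg]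
        | one_tmul a =>
          induction b using extension_induction with
          | add b b' h h' => simp only [map_add, h, h']; abel
          | smul r b h => simp only [map_smul, h, smul_sub, smul_add, smul_neg]
          | one_tmul b =>
            simp only [LinearMap.baseChange_tmul, ext₂_one_tmul, extApp_tmul, one_mul,
              twoFormOp_one_tmul, ← TensorProduct.tmul_neg, ← TensorProduct.tmul_sub,
              ← TensorProduct.tmul_add]
            rfl

/-- The Maurer–Cartan expression measures how far the graph is from being closed under the
bracket. -/
theorem twoFormOp_curvature [CharZero 𝕂] :
    twoFormOp (P.formD.baseChange 𝒜 X + (2⁻¹ : 𝕂) • ext₂ 𝒜 P.formBr₂ X X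
        + (6⁻¹ : 𝕂) • ext₃ 𝒜 P.formBr₃ X X X) a b =
      P.extPrB 𝒜 (ext₂ 𝒜 P.LL.bracket (P.graphMap X a) (P.graphMap X b))
        - formOp X (P.extPrA 𝒜 (ext₂ 𝒜 P.LL.bracket (P.graphMap X a) (P.graphMap X b))) := by
  have hskew : P.extPrB 𝒜 (ext₂ 𝒜 P.LL.bracket (P.extI 𝒜 b) (P.extJ 𝒜 (formOp X a)))
      = -P.extPrB 𝒜 (ext₂ 𝒜 P.LL.bracket (P.extJ 𝒜 (formOp X a)) (P.extI 𝒜 b)) := by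
    rw [← map_neg]
    exact congrArg _ (P.LL.cartesian_skew _ _)
  have hII : ext₂ 𝒜 P.LL.bracket (P.extI 𝒜 a) (P.extI 𝒜 b)
      = P.extI 𝒜 (ext₂ 𝒜 P.LA.bracket a b) := (P.extI_bracket a b).symm
  simp only [map_add, LinearMap.map_smul_of_tower, LinearMap.add_apply, LinearMap.smul_apply,
    twoFormOp_formD, twoFormOp_formBr₂, twoFormOp_formBr₃, hskew, graphMap_apply, hII,
    extPrB_extI, extPrA_extI]
  module

end MaurerCartan

variable {ξ : 𝒜 ⊗[𝕂] (ΓA →ₗ[R] ΓB)}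

theorem standard_bracket (a b : 𝒜 ⊗[𝕂] ΓA) : (P.standard ξ).str.bracket a b =
    P.extPrA 𝒜 ((P.LL.cartesian 𝒜).bracket (P.graphMap ξ a) (P.graphMap ξ b)) :=
  rfl

theorem standard_anchor (a : 𝒜 ⊗[𝕂] ΓA) :
    (P.standard ξ).str.anchor a = (P.LL.cartesian 𝒜).anchor (P.graphMap ξ a) :=
  rfl

namespace IsMaurerCartan

variable {P} [IsLocalRing 𝒜] (hξ : P.IsMaurerCartan ξ)
include hξ

theorem evMap_standard_bracket (ev : 𝒜 →ₐ[𝕂] 𝕂) (a b : 𝒜 ⊗[𝕂] ΓA) :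
    evMap ΓA ev ((P.standard ξ).str.bracket a b) =
      P.LA.bracket (evMap ΓA ev a) (evMap ΓA ev b) := by
  change evMap ΓA ev (P.extPrA 𝒜 (ext₂ 𝒜 P.LL.bracket _ _)) = _
  rw [evMap_baseChange, evMap_ext₂, P.evMap_graphMap a ev hξ.1, P.evMap_graphMap b ev hξ.1,
    ← P.i_bracket]
  exact P.prA_i _

theorem standard_hasCenter (ev : 𝒜 →ₐ[𝕂] 𝕂) : (P.standard ξ).str.HasCenter ev P.LA := by
  refine ⟨fun a b => ?_, fun a => ?_⟩
  · simp [hξ.evMap_standard_bracket ev]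
  · change evMap _ ev ((P.LL.anchor.restrictScalars 𝕂).baseChange 𝒜 (P.graphMap ξ (1 ⊗ₜ a))) = _
    rw [evMap_baseChange, P.evMap_graphMap _ ev hξ.1]
    simp [P.i_anchor]

variable [CharZero 𝕂]

theorem graphMap_standard_bracket (a b : 𝒜 ⊗[𝕂] ΓA) :
    P.graphMap ξ ((P.standard ξ).str.bracket a b) =
      (P.LL.cartesian 𝒜).bracket (P.graphMap ξ a) (P.graphMap ξ b) := by
  have hcurv := P.twoFormOp_curvature ξ a b
  have hzero : P.formD.baseChange 𝒜 ξ + (2⁻¹ : 𝕂) • ext₂ 𝒜 P.formBr₂ ξ ξ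
      + (6⁻¹ : 𝕂) • ext₃ 𝒜 P.formBr₃ ξ ξ ξ = 0 := hξ.2
  rw [hzero, map_zero, LinearMap.zero_apply, LinearMap.zero_apply, eq_comm, sub_eq_zero] at hcurv
  rw [standard_bracket, graphMap_apply]
  exact (congrArg _ (congrArg _ hcurv.symm)).trans (P.extI_extPrA_add_extJ_extPrB _)

theorem standard_isLieAlgebroid : (P.standard ξ).str.IsLieAlgebroid where
  anchor_fmul f a := by
    rw [standard_anchor, graphMap_fmul, P.LL.cartesian_isLieAlgebroid.anchor_fmul, standard_anchor]
  bracket_self a := Function.LeftInverse.injective (P.extPrA_graphMap ξ) <| by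
    rw [hξ.graphMap_standard_bracket, P.LL.cartesian_isLieAlgebroid.bracket_self, map_zero]
  jacobi a b c := Function.LeftInverse.injective (P.extPrA_graphMap ξ) <| by
    simp only [map_add, hξ.graphMap_standard_bracket]
    exact P.LL.cartesian_isLieAlgebroid.jacobi _ _ _
  leibniz a f b := Function.LeftInverse.injective (P.extPrA_graphMap ξ) <| by
    rw [map_add, hξ.graphMap_standard_bracket, graphMap_fmul, graphMap_fmul, graphMap_fmul,
      hξ.graphMap_standard_bracket, standard_anchor]
    exact P.LL.cartesian_isLieAlgebroid.leibniz _ _ _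

theorem isInfinitesimalDeformation_standard (ev : 𝒜 →ₐ[𝕂] 𝕂) :
    P.IsInfinitesimalDeformation ev (P.standard ξ) where
  isLieAlgebroid := hξ.standard_isLieAlgebroid
  hasCenter := hξ.standard_hasCenter ev
  isHom :=
    { small := fun f => by simp [standard]
      map_fmul := fun f a => P.graphMap_fmul ξ a f
      map_bracket := hξ.graphMap_standard_bracket
      map_anchor := fun _ _ => rfl }
  center_I a := (P.evMap_graphMap _ ev hξ.1).trans (by simp)

end IsMaurerCartan

end SplitPair

end StandardDeformations

/-! ## The exponential action of a cubic algebra -/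

section CubicGauge

open Finset.HasAntidiagonal

theorem sum_antidiagonal_succ_symm {𝕂 X : Type*} [Field 𝕂] [CharZero 𝕂] [AddCommGroup X]
    [Module 𝕂 X] (f : ℕ → ℕ → X) (n : ℕ) :
    ∑ kl ∈ antidiagonal (n + 1), ((n + 1).choose kl.1 : 𝕂) • f kl.1 kl.2 =
      f 0 (n + 1) + f (n + 1) 0 + (2 : 𝕂)⁻¹ • ∑ p : Fin n, ((n + 1).choose (p + 1) : 𝕂) •
        (f (n - p) (p + 1) + f (p + 1) (n - p)) := by
  have hreflect : ∑ p ∈ Finset.range n, ((n + 1).choose (p + 1) : 𝕂) • f (n - p) (p + 1) =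
      ∑ p ∈ Finset.range n, ((n + 1).choose (p + 1) : 𝕂) • f (p + 1) (n - p) := by
    rw [← Finset.sum_range_reflect]
    refine Finset.sum_congr rfl fun p hp => ?_
    have hp' := Finset.mem_range.1 hp
    rw [show n - (n - 1 - p) = p + 1 by omega, show n - 1 - p + 1 = n + 1 - (p + 1) by omega,
      Nat.choose_symm (by omega), Nat.add_sub_add_right]
  rw [Finset.Nat.sum_antidiagonal_eq_sum_range_succ_mk, Finset.sum_range_succ,
    Finset.sum_range_succ']
  simp only [Nat.choose_self, Nat.choose_zero_right, Nat.cast_one, one_smul, Nat.sub_self,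
    Nat.sub_zero, smul_add, Finset.sum_add_distrib, Nat.add_sub_add_right]
  rw [Fin.sum_univ_eq_sum_range (fun p => ((n + 1).choose (p + 1) : 𝕂) • f (n - p) (p + 1)),
    Fin.sum_univ_eq_sum_range (fun p => ((n + 1).choose (p + 1) : 𝕂) • f (p + 1) (n - p)),
    hreflect]
  module

variable {𝕂 : Type*} [Field 𝕂] {𝒜 : Type*} [CommRing 𝒜] [Algebra 𝕂 𝒜]
  {g₀ g₁ g₂ : Type*} [AddCommGroup g₀] [Module 𝕂 g₀] [AddCommGroup g₁] [Module 𝕂 g₁]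
  [AddCommGroup g₂] [Module 𝕂 g₂] (C : CubicBrackets 𝕂 g₀ g₁ g₂)

namespace CubicBrackets

theorem expTerm_mem {I : Ideal 𝒜} (ξ : 𝒜 ⊗[𝕂] g₁) {b : 𝒜 ⊗[𝕂] g₀}
    (hb : b ∈ I • (⊤ : Submodule 𝒜 (𝒜 ⊗[𝕂] g₀))) (n : ℕ) :
    C.expTerm ξ b (n + 1) ∈ I ^ (n + 1) • (⊤ : Submodule 𝒜 (𝒜 ⊗[𝕂] g₁)) := by
  have hξ : ξ ∈ (1 : Ideal 𝒜) • (⊤ : Submodule 𝒜 (𝒜 ⊗[𝕂] g₁)) := by simp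
  have binary {J : Ideal 𝒜} {x : 𝒜 ⊗[𝕂] g₁} (hx : x ∈ J • (⊤ : Submodule 𝒜 (𝒜 ⊗[𝕂] g₁))) :
      ext₂ 𝒜 C.br₀₁ b x ∈ (I * J) • (⊤ : Submodule 𝒜 (𝒜 ⊗[𝕂] g₁)) :=
    bilinear_mem_mul_smul_top _ hb hx
  have ternary {J K : Ideal 𝒜} {x y : 𝒜 ⊗[𝕂] g₁}
      (hx : x ∈ J • (⊤ : Submodule 𝒜 (𝒜 ⊗[𝕂] g₁)))
      (hy : y ∈ K • (⊤ : Submodule 𝒜 (𝒜 ⊗[𝕂] g₁))) :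
      ext₃ 𝒜 C.br₀₁₁ b x y ∈ (I * J * K) • (⊤ : Submodule 𝒜 (𝒜 ⊗[𝕂] g₁)) :=
    bilinear_mem_mul_smul_top (extApp 𝒜 g₁ g₁) (bilinear_mem_mul_smul_top _ hb hx) hy
  induction n using Nat.strong_induction_on with
  | _ n ih =>
    rcases n with _ | n
    · rw [expTerm, twisted₁, zero_add, pow_one]
      refine add_mem (sub_mem (Submodule.smul_top_le_comap_smul_top I _ hb) ?_)
        (Submodule.smul_of_tower_mem _ _ ?_)
      · simpa only [mul_one] using binary hξ
      · simpa only [mul_one] using ternary hξ hξ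
    · rw [expTerm, twisted₂]
      refine add_mem (sub_mem ?_ ?_) (Submodule.smul_of_tower_mem _ _
        (sum_mem fun p _ => Submodule.smul_of_tower_mem _ _ ?_))
      · rw [pow_succ']
        exact binary (ih n (by omega))
      · simpa only [mul_one, ← pow_succ'] using ternary hξ (ih n (by omega))
      · have hp := p.2
        have hmem := ternary (ih p (by omega)) (ih (n - p - 1) (by omega))
        rwa [← pow_succ', ← pow_add, show n - p - 1 + 1 = n - p by omega,
          show (p : ℕ) + 1 + 1 + (n - p) = n + 1 + 1 by omega] at hmem

theorem exists_forall_expTerm_eq_zero [IsLocalRing 𝒜] [IsArtinianRing 𝒜] (ξ : 𝒜 ⊗[𝕂] g₁)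
    {b : 𝒜 ⊗[𝕂] g₀} (hb : b ∈ mPart 𝕂 𝒜 g₀) :
    ∃ N, ∀ n, N ≤ n → C.expTerm ξ b (n + 1) = 0 := by
  obtain ⟨N, hN⟩ := (isArtinianRing_iff_isNilpotent_maximalIdeal 𝒜).1 inferInstance
  refine ⟨N, fun n hn => ?_⟩
  have hmem := C.expTerm_mem ξ hb n
  rwa [pow_eq_zero_of_le (hn.trans n.le_succ) hN, Submodule.zero_eq_bot, Submodule.bot_smul,
    Submodule.mem_bot] at hmem

variable [CharZero 𝕂] {S : Type*} [Ring S] [Module 𝕂 S] [Module ℚ S] (h : 𝒜 ⊗[𝕂] g₁ →ₗ[𝕂] S)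

theorem map_expAct {ξ : 𝒜 ⊗[𝕂] g₁} {b : 𝒜 ⊗[𝕂] g₀} {N : ℕ}
    (hN : ∀ n, N ≤ n → C.expTerm ξ b (n + 1) = 0) :
    h (C.expAct b ξ) =
      ∑ n ∈ Finset.range (N + 1), (n.factorial : ℚ)⁻¹ • -h (C.expTerm ξ b n) := by
  rw [expAct, finsum_eq_sum_of_support_subset (s := Finset.range N), map_sub, map_sum,
    Finset.sum_range_succ', expTerm, map_neg, neg_neg, Nat.factorial_zero, Nat.cast_one, inv_one,
    one_smul, add_comm, sub_eq_add_neg, ← Finset.sum_neg_distrib]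
  · refine congrArg _ (Finset.sum_congr rfl fun n _ => ?_)
    rw [map_smul, ← smul_neg, ← Rat.cast_smul_eq_qsmul 𝕂, Rat.cast_inv, Rat.cast_natCast]
  · intro n hn
    by_contra hnN
    exact hn (by simp only [hN n (by simpa using hnN), smul_zero])

theorem exp_mul_add_map {ξ : 𝒜 ⊗[𝕂] g₁} {b : 𝒜 ⊗[𝕂] g₀} {p q D : S} (hpq : p + q = 1)
    (hqp : q * p = 0) (hqh : ∀ x, q * h x = h x) (hhp : ∀ x, h x * p = h x)
    (h₀ : h (C.d₀.baseChange 𝒜 b) = -(q * D * p))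
    (h₁ : ∀ x, h (ext₂ 𝒜 C.br₀₁ b x) = q * D * h x - h x * D * p)
    (h₂ : ∀ x y, h (ext₃ 𝒜 C.br₀₁₁ b x y) = h y * D * h x + h x * D * h y)
    (hD : IsNilpotent D) {N : ℕ} (hN : ∀ n, N ≤ n → C.expTerm ξ b (n + 1) = 0) :
    IsNilpotent.exp D * (p + h ξ) =
      (p + h (C.expAct b ξ)) * (p * IsNilpotent.exp D * (p + h ξ)) := by
  let c (n : ℕ) : S := -h (C.expTerm ξ b n)
  have hc₀ : c 0 = h ξ := by simp only [c, expTerm, map_neg, neg_neg]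
  have hc : ∀ n, N + 1 ≤ n → c n = 0 := fun n hn => by
    obtain ⟨m, rfl⟩ := Nat.exists_eq_add_of_le' (Nat.one_le_of_lt hn)
    simp only [c, hN m (by omega), map_zero, neg_zero]
  have hc₁ : c 1 = (q - c 0) * D * (p + c 0) := by
    rw [hc₀]
    simp only [c, expTerm, twisted₁, map_add, map_sub, map_smul, h₀, h₁, h₂]
    rw [← two_smul 𝕂, smul_smul, inv_mul_cancel₀ two_ne_zero, one_smul]
    noncomm_ring
  have hrec (n : ℕ) : c (n + 2) = q * D * c (n + 1) - c (n + 1) * D * p -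
      ∑ kl ∈ antidiagonal (n + 1),
        ((n + 1).choose kl.1 : ℚ) • (c kl.1 * D * c kl.2) := by
    have hcast (k : ℕ) (x : S) : (k : ℚ) • x = (k : 𝕂) • x := by
      rw [Nat.cast_smul_eq_nsmul, Nat.cast_smul_eq_nsmul]
    simp only [hcast]
    rw [sum_antidiagonal_succ_symm fun k l => c k * D * c l, hc₀]
    simp only [c, expTerm, twisted₂, twisted₃, map_add, map_sub, map_sum, map_smul, h₁, h₂,
      neg_mul, mul_neg, neg_neg]
    abel
  have hriccati := riccati_exp_mul_eq hpq hqp (fun n => by rw [mul_neg, hqh])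
    (fun n => by rw [neg_mul, hhp]) hD hc hc₁ hrec
  rw [← C.map_expAct h hN, hc₀] at hriccati
  have hpp : p * p = p := by rw [← add_zero (p * p), ← hqp, ← add_mul, hpq, one_mul]
  calc IsNilpotent.exp D * (p + h ξ)
      = p * IsNilpotent.exp D * (p + h ξ) + q * IsNilpotent.exp D * (p + h ξ) := by
        rw [← add_mul, ← add_mul, hpq, one_mul]
    _ = (p * p + h (C.expAct b ξ) * p) * (IsNilpotent.exp D * (p + h ξ)) := by
        rw [← hriccati, hhp, hpp]
        noncomm_ring
    _ = (p + h (C.expAct b ξ)) * (p * IsNilpotent.exp D * (p + h ξ)) := by noncomm_ring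

end CubicBrackets

end CubicGauge

/-! ## Gauge equivalence and weak isomorphism -/

section Gauge

variable {𝕂 : Type*} [Field 𝕂] {R : Type*} [CommRing R] [Algebra 𝕂 R]
  {ΓA : Type*} [AddCommGroup ΓA] [Module 𝕂 ΓA] [Module R ΓA] [IsScalarTower 𝕂 R ΓA]
  {ΓL : Type*} [AddCommGroup ΓL] [Module 𝕂 ΓL] [Module R ΓL] [IsScalarTower 𝕂 R ΓL]
  {ΓB : Type*} [AddCommGroup ΓB] [Module 𝕂 ΓB] [Module R ΓB] [IsScalarTower 𝕂 R ΓB]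
  (P : SplitPair 𝕂 R ΓA ΓL ΓB) {𝒜 : Type*} [CommRing 𝒜] [Algebra 𝕂 𝒜]

namespace SplitPair

/-- The derivation `δ + [j b, -]` of `L` through which `(δ, b) ∈ Der(L) ⊕ Γ(B)` acts. -/
def totalDer : P.LL.Der × ΓB →ₗ[𝕂] P.LL.Der :=
  LinearMap.id.coprod (P.LL.ad ∘ₗ P.j.restrictScalars 𝕂)

/-- The operator on `Γ(L_𝒜)` through which an element of `(Der(L) ⊕ Γ(B)) ⊗ 𝒜` acts. -/
def gaugeOp : 𝒜 ⊗[𝕂] (P.LL.Der × ΓB) →ₗ[𝒜] Module.End 𝒜 (𝒜 ⊗[𝕂] ΓL) :=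
  ext₂ 𝒜 (P.LL.derOp ∘ₗ P.totalDer)

omit [IsScalarTower 𝕂 R ΓA] in
theorem totalDer_apply (δ : P.LL.Der × ΓB) (l : ΓL) :
    P.LL.derOp (P.totalDer δ) l = δ.1.1.1 l + P.LL.bracket (P.j δ.2) l :=
  rfl

theorem extended_d₀_apply (δ : P.LL.Der × ΓB) (a : ΓA) :
    P.extended.d₀ δ a = -P.prB (P.LL.derOp (P.totalDer δ) (P.i a)) := by
  rw [totalDer_apply, P.LL.skew (P.j δ.2), map_add, map_neg, neg_add, neg_neg]
  rfl

theorem extended_br₀₁_apply (δ : P.LL.Der × ΓB) (X : ΓA →ₗ[R] ΓB) (a : ΓA) :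
    P.extended.br₀₁ δ X a = P.prB (P.LL.derOp (P.totalDer δ) (P.j (X a))) -
      X (P.prA (P.LL.derOp (P.totalDer δ) (P.i a))) := by
  simp only [totalDer_apply, map_add, add_sub_add_comm]
  rfl

theorem extended_br₀₁₁_apply (δ : P.LL.Der × ΓB) (X Y : ΓA →ₗ[R] ΓB) (a : ΓA) :
    P.extended.br₀₁₁ δ X Y a = Y (P.prA (P.LL.derOp (P.totalDer δ) (P.j (X a)))) +
      X (P.prA (P.LL.derOp (P.totalDer δ) (P.j (Y a)))) := by
  simp only [totalDer_apply, map_add]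
  rw [add_add_add_comm]
  rfl

section Brackets

variable (b : 𝒜 ⊗[𝕂] (P.LL.Der × ΓB)) (X Y : 𝒜 ⊗[𝕂] (ΓA →ₗ[R] ΓB)) (a : 𝒜 ⊗[𝕂] ΓA)

theorem formOp_d₀ :
    formOp (P.extended.d₀.baseChange 𝒜 b) a = -P.extPrB 𝒜 (P.gaugeOp b (P.extI 𝒜 a)) := by
  rw [formOp_eq_ext₂, gaugeOp]
  induction b using extension_induction with
  | add b b' h h' => simp only [map_add, LinearMap.add_apply, h, h', neg_add]
  | smul r b h => simp only [map_smul, LinearMap.smul_apply, h, smul_neg]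
  | one_tmul δ =>
    induction a using extension_induction with
    | add a a' h h' => simp only [map_add, h, h', neg_add]
    | smul r a h => simp only [map_smul, h, smul_neg]
    | one_tmul a =>
      simp only [LinearMap.baseChange_tmul, ext₂_one_tmul, LinearMap.restrictScalars_apply,
        LinearMap.restrictScalarsₗ_apply, extended_d₀_apply, LinearMap.comp_apply,
        TensorProduct.tmul_neg]

theorem formOp_br₀₁ :
    formOp (ext₂ 𝒜 P.extended.br₀₁ b X) a =
      P.extPrB 𝒜 (P.gaugeOp b (P.extJ 𝒜 (formOp X a))) -
        formOp X (P.extPrA 𝒜 (P.gaugeOp b (P.extI 𝒜 a))) := by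
  rw [formOp_eq_ext₂, formOp_eq_ext₂, gaugeOp]
  induction b using extension_induction with
  | add b b' h h' => simp only [map_add, LinearMap.add_apply, h, h']; abel
  | smul r b h => simp only [map_smul, LinearMap.smul_apply, h, smul_sub]
  | one_tmul δ =>
    induction X using extension_induction with
    | add X X' h h' => simp only [map_add, LinearMap.add_apply, h, h']; abel
    | smul r X h => simp only [map_smul, LinearMap.smul_apply, h, smul_sub]
    | one_tmul X =>
      induction a using extension_induction with
      | add a a' h h' => simp only [map_add, h, h']; abel
      | smul r a h => simp only [map_smul, h, smul_sub]
      | one_tmul a =>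
        simp only [LinearMap.baseChange_tmul, ext₂_one_tmul, LinearMap.restrictScalars_apply,
          LinearMap.restrictScalarsₗ_apply, extended_br₀₁_apply, LinearMap.comp_apply,
          TensorProduct.tmul_sub]

theorem formOp_br₀₁₁ :
    formOp (ext₃ 𝒜 P.extended.br₀₁₁ b X Y) a =
      formOp Y (P.extPrA 𝒜 (P.gaugeOp b (P.extJ 𝒜 (formOp X a)))) +
        formOp X (P.extPrA 𝒜 (P.gaugeOp b (P.extJ 𝒜 (formOp Y a)))) := by
  rw [formOp_eq_ext₂, formOp_eq_ext₂, formOp_eq_ext₂, gaugeOp, ext₃]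
  induction b using extension_induction with
  | add b b' h h' => simp only [map_add, LinearMap.add_apply, h, h']; abel
  | smul r b h => simp only [map_smul, LinearMap.smul_apply, h, smul_add]
  | one_tmul δ =>
    induction X using extension_induction with
    | add X X' h h' => simp only [map_add, LinearMap.add_apply, h, h']; abel
    | smul r X h => simp only [map_smul, LinearMap.smul_apply, h, smul_add]
    | one_tmul X =>
      induction Y using extension_induction with
      | add Y Y' h h' => simp only [map_add, LinearMap.add_apply, h, h']; abel
      | smul r Y h => simp only [map_smul, LinearMap.smul_apply, h, smul_add]
      | one_tmul Y =>
        induction a using extension_induction with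
        | add a a' h h' => simp only [map_add, h, h']; abel
        | smul r a h => simp only [map_smul, h, smul_add]
        | one_tmul a =>
          simp only [LinearMap.baseChange_tmul, ext₂_one_tmul, extApp_tmul, one_mul,
            LinearMap.restrictScalars_apply, LinearMap.restrictScalarsₗ_apply,
            extended_br₀₁₁_apply, LinearMap.comp_apply, TensorProduct.tmul_add]

end Brackets

variable (𝒜) in
/-- The projection of `Γ(L_𝒜)` onto `Γ(A_𝒜)` along `Γ(B_𝒜)`. -/
def projA : Module.End 𝒜 (𝒜 ⊗[𝕂] ΓL) :=
  P.extI 𝒜 ∘ₗ P.extPrA 𝒜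

variable (𝒜) in
/-- The projection of `Γ(L_𝒜)` onto `Γ(B_𝒜)` along `Γ(A_𝒜)`. -/
def projB : Module.End 𝒜 (𝒜 ⊗[𝕂] ΓL) :=
  P.extJ 𝒜 ∘ₗ P.extPrB 𝒜

/-- The endomorphism `j ∘ X ∘ prA` of `Γ(L_𝒜)` given by a form `X ∈ Γ(A* ⊗ B) ⊗ 𝒜`. -/
def formEnd : 𝒜 ⊗[𝕂] (ΓA →ₗ[R] ΓB) →ₗ[𝕂] Module.End 𝒜 (𝒜 ⊗[𝕂] ΓL) where
  toFun X := P.extJ 𝒜 ∘ₗ formOp X ∘ₗ P.extPrA 𝒜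
  map_add' X Y := by
    simp only [formOp_eq_ext₂, map_add, LinearMap.add_comp, LinearMap.comp_add]
  map_smul' c X := by
    simp only [formOp_eq_ext₂, LinearMap.map_smul_of_tower, LinearMap.smul_comp,
      LinearMap.comp_smul, RingHom.id_apply]

theorem formEnd_apply (X : 𝒜 ⊗[𝕂] (ΓA →ₗ[R] ΓB)) (l : 𝒜 ⊗[𝕂] ΓL) :
    P.formEnd X l = P.extJ 𝒜 (formOp X (P.extPrA 𝒜 l)) :=
  rfl

theorem projA_add_formEnd_extI (ξ : 𝒜 ⊗[𝕂] (ΓA →ₗ[R] ΓB)) (a : 𝒜 ⊗[𝕂] ΓA) :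
    (P.projA 𝒜 + P.formEnd ξ) (P.extI 𝒜 a) = P.graphMap ξ a := by
  rw [LinearMap.add_apply, projA, LinearMap.comp_apply, formEnd_apply, extPrA_extI, graphMap_apply]

theorem projA_add_projB : P.projA 𝒜 + P.projB 𝒜 = 1 :=
  LinearMap.ext P.extI_extPrA_add_extJ_extPrB

theorem projB_mul_projA : P.projB 𝒜 * P.projA 𝒜 = 0 :=
  LinearMap.ext fun _ => (congrArg (P.extJ 𝒜) (P.extPrB_extI _)).trans (map_zero _)

section FormEnd

variable (b : 𝒜 ⊗[𝕂] (P.LL.Der × ΓB)) (X Y : 𝒜 ⊗[𝕂] (ΓA →ₗ[R] ΓB))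

theorem projB_mul_formEnd : P.projB 𝒜 * P.formEnd X = P.formEnd X :=
  LinearMap.ext fun _ => congrArg (P.extJ 𝒜) (P.extPrB_extJ _)

theorem formEnd_mul_projA : P.formEnd X * P.projA 𝒜 = P.formEnd X := by
  refine LinearMap.ext fun l => ?_
  rw [Module.End.mul_apply, formEnd_apply, formEnd_apply, projA, LinearMap.comp_apply, extPrA_extI]

theorem formEnd_d₀ :
    P.formEnd (P.extended.d₀.baseChange 𝒜 b) = -(P.projB 𝒜 * P.gaugeOp b * P.projA 𝒜) := by
  refine LinearMap.ext fun l => ?_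
  rw [formEnd_apply, formOp_d₀, map_neg]
  rfl

theorem formEnd_br₀₁ :
    P.formEnd (ext₂ 𝒜 P.extended.br₀₁ b X) =
      P.projB 𝒜 * P.gaugeOp b * P.formEnd X - P.formEnd X * P.gaugeOp b * P.projA 𝒜 := by
  refine LinearMap.ext fun l => ?_
  rw [formEnd_apply, formOp_br₀₁, map_sub]
  rfl

theorem formEnd_br₀₁₁ :
    P.formEnd (ext₃ 𝒜 P.extended.br₀₁₁ b X Y) =
      P.formEnd Y * P.gaugeOp b * P.formEnd X + P.formEnd X * P.gaugeOp b * P.formEnd Y := by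
  refine LinearMap.ext fun l => ?_
  rw [formEnd_apply, formOp_br₀₁₁, map_add]
  rfl

end FormEnd

variable [IsLocalRing 𝒜]

theorem isRingedHom_of_comp_graphMap [CharZero 𝕂] {ev : 𝒜 →ₐ[𝕂] 𝕂}
    {ξ η : 𝒜 ⊗[𝕂] (ΓA →ₗ[R] ΓB)} (hη : P.IsMaurerCartan η)
    {Φ : Module.End 𝒜 (𝒜 ⊗[𝕂] ΓL)} {μ : 𝒜 ⊗[𝕂] R →ₐ[𝒜] 𝒜 ⊗[𝕂] R} (hΦ : P.LL.IsSmallAut ev Φ μ)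
    {ψ : Module.End 𝒜 (𝒜 ⊗[𝕂] ΓA)} (h : Φ ∘ₗ P.graphMap η = P.graphMap ξ ∘ₗ ψ) :
    IsRingedHom ev (P.standard η).str (P.standard ξ).str ψ μ := by
  have hΦψ (a : 𝒜 ⊗[𝕂] ΓA) : Φ (P.graphMap η a) = P.graphMap ξ (ψ a) := LinearMap.congr_fun h a
  have hψ (a : 𝒜 ⊗[𝕂] ΓA) : ψ a = P.extPrA 𝒜 (Φ (P.graphMap η a)) := by
    rw [hΦψ, extPrA_graphMap]
  refine ⟨hΦ.1.small, fun f u => ?_, fun u v => ?_, fun u f => ?_⟩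
  · rw [hψ, graphMap_fmul, hΦ.1.map_fmul, extPrA, baseChange_fmul, ← hψ]
  · rw [hψ, hη.graphMap_standard_bracket, hΦ.1.map_bracket, hΦψ, hΦψ, standard_bracket]
  · rw [standard_anchor, standard_anchor, hΦ.1.map_anchor, hΦψ]

theorem weaklyIsomorphic_standard_iff [CharZero 𝕂] {ev : 𝒜 →ₐ[𝕂] 𝕂}
    {ξ η : 𝒜 ⊗[𝕂] (ΓA →ₗ[R] ΓB)} (hη : P.IsMaurerCartan η) :
    P.WeaklyIsomorphic ev (P.standard ξ) (P.standard η) ↔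
      ∃ Φ, (∃ μ, P.LL.IsSmallAut ev Φ μ) ∧ ∃ ψ, Φ ∘ₗ P.graphMap η = P.graphMap ξ ∘ₗ ψ := by
  constructor
  · rintro ⟨Φ, μ, hΦ, ψ, -, -, hψ, -⟩
    exact ⟨Φ, ⟨μ, hΦ⟩, ψ, hψ⟩
  · rintro ⟨Φ, ⟨μ, hΦ⟩, ψ, hψ⟩
    exact ⟨Φ, μ, hΦ, ψ, μ, P.isRingedHom_of_comp_graphMap hη hΦ hψ, hψ, rfl⟩

variable [IsArtinianRing 𝒜]

theorem isUnit_of_comp_graphMap {ev : 𝒜 →ₐ[𝕂] 𝕂} {ξ η : 𝒜 ⊗[𝕂] (ΓA →ₗ[R] ΓB)}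
    {Φ : Module.End 𝒜 (𝒜 ⊗[𝕂] ΓL)} (hΦ : ∀ l, center ev Φ l = l)
    {ψ : Module.End 𝒜 (𝒜 ⊗[𝕂] ΓA)} (h : Φ ∘ₗ P.graphMap ξ = P.graphMap η ∘ₗ ψ) : IsUnit ψ := by
  refine isUnit_of_center_eq_self (ev := ev) fun a => ?_
  have hψ : ψ (1 ⊗ₜ a) = P.extPrA 𝒜 (Φ (P.graphMap ξ (1 ⊗ₜ a))) := by
    rw [← LinearMap.comp_apply Φ, h, LinearMap.comp_apply, extPrA_graphMap]
  rw [center, hψ, evMap_baseChange, evMap_apply, hΦ, ← evMap_baseChange, extPrA_graphMap,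
    evMap_tmul, map_one, one_smul]

section Exponential

variable (ev : 𝒜 →ₐ[𝕂] 𝕂) {b : 𝒜 ⊗[𝕂] (P.LL.Der × ΓB)} (hb : b ∈ mPart 𝕂 𝒜 (P.LL.Der × ΓB))
include ev hb

omit [IsScalarTower 𝕂 R ΓA] [IsArtinianRing 𝒜] in
theorem center_gaugeOp (l : ΓL) : center ev (P.gaugeOp b) l = 0 := by
  rw [gaugeOp, center_ext₂, (mem_mPart_iff ev).1 hb, map_zero, LinearMap.zero_apply]

omit [IsScalarTower 𝕂 R ΓA] in
theorem isNilpotent_gaugeOp : IsNilpotent (P.gaugeOp b) :=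
  isNilpotent_of_center_eq_zero (P.center_gaugeOp ev hb)

variable [CharZero 𝕂] [Module ℚ (𝒜 ⊗[𝕂] ΓL)]

theorem exp_gaugeOp_mul_projA_add_formEnd (ξ : 𝒜 ⊗[𝕂] (ΓA →ₗ[R] ΓB)) :
    IsNilpotent.exp (P.gaugeOp b) * (P.projA 𝒜 + P.formEnd ξ) =
      (P.projA 𝒜 + P.formEnd (P.extended.expAct b ξ)) *
        (P.projA 𝒜 * IsNilpotent.exp (P.gaugeOp b) * (P.projA 𝒜 + P.formEnd ξ)) := by
  obtain ⟨N, hN⟩ := P.extended.exists_forall_expTerm_eq_zero ξ hb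
  have riccati := P.extended.exp_mul_add_map P.formEnd (ξ := ξ) (b := b) (p := P.projA 𝒜)
    (q := P.projB 𝒜) (D := P.gaugeOp b) (N := N)
  exact riccati P.projA_add_projB P.projB_mul_projA P.projB_mul_formEnd P.formEnd_mul_projA
    (P.formEnd_d₀ b) (P.formEnd_br₀₁ b) (P.formEnd_br₀₁₁ b) (P.isNilpotent_gaugeOp ev hb) hN

theorem exp_gaugeOp_comp_graphMap (ξ : 𝒜 ⊗[𝕂] (ΓA →ₗ[R] ΓB)) :
    IsNilpotent.exp (P.gaugeOp b) ∘ₗ P.graphMap ξ =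
      P.graphMap (P.extended.expAct b ξ) ∘ₗ
        P.extPrA 𝒜 ∘ₗ IsNilpotent.exp (P.gaugeOp b) ∘ₗ P.graphMap ξ := by
  refine LinearMap.ext fun a => ?_
  have h := LinearMap.congr_fun (P.exp_gaugeOp_mul_projA_add_formEnd ev hb ξ) (P.extI 𝒜 a)
  simp only [Module.End.mul_apply, projA_add_formEnd_extI] at h
  exact h.trans (P.projA_add_formEnd_extI _ _)

theorem expAct_eq_iff {ξ η : 𝒜 ⊗[𝕂] (ΓA →ₗ[R] ΓB)} :
    P.extended.expAct b ξ = η ↔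
      ∃ ψ, IsNilpotent.exp (P.gaugeOp b) ∘ₗ P.graphMap ξ = P.graphMap η ∘ₗ ψ := by
  have hexp := P.exp_gaugeOp_comp_graphMap ev hb ξ
  refine ⟨fun h => ⟨_, h ▸ hexp⟩, fun ⟨ψ, hψ⟩ => P.graphMap_injective (LinearMap.ext fun a => ?_)⟩
  obtain ⟨χ, hχ⟩ :=
    (P.isUnit_of_comp_graphMap (center_exp (P.center_gaugeOp ev hb)) hψ).exists_right_inv
  have hψχ : ψ (χ a) = a := LinearMap.congr_fun hχ a
  have h := LinearMap.congr_fun hexp (χ a)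
  rw [hψ] at h
  simp only [LinearMap.comp_apply, hψχ, extPrA_graphMap] at h
  exact h.symm

end Exponential

section Equivalence

variable [Module ℚ (𝒜 ⊗[𝕂] ΓL)]

omit [IsScalarTower 𝕂 R ΓA] in
theorem exists_isSmallAut_iff_exists_gaugeOp [Module ℚ (𝒜 ⊗[𝕂] R)] {ev : 𝒜 →ₐ[𝕂] 𝕂}
    {Φ : Module.End 𝒜 (𝒜 ⊗[𝕂] ΓL)} :
    (∃ μ, P.LL.IsSmallAut ev Φ μ) ↔
      ∃ b ∈ mPart 𝕂 𝒜 (P.LL.Der × ΓB), IsNilpotent.exp (P.gaugeOp b) = Φ := by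
  rw [LieAlgebroidStr.exists_isSmallAut_iff, gaugeOp, ext₂_comp]
  constructor
  · rintro ⟨D, hD, rfl⟩
    refine ⟨(LinearMap.inl 𝕂 P.LL.Der ΓB).baseChange 𝒜 D,
      Submodule.smul_top_le_comap_smul_top _ _ hD, ?_⟩
    rw [LinearMap.comp_apply, ← LinearMap.comp_apply (LinearMap.baseChange _ _),
      ← LinearMap.baseChange_comp, totalDer, LinearMap.coprod_inl, LinearMap.baseChange_id,
      LinearMap.id_apply]
  · rintro ⟨b, hb, rfl⟩
    exact ⟨P.totalDer.baseChange 𝒜 b, Submodule.smul_top_le_comap_smul_top _ _ hb, rfl⟩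

variable [CharZero 𝕂]

theorem gaugeEquivalent_iff (ev : 𝒜 →ₐ[𝕂] 𝕂) {ξ η : 𝒜 ⊗[𝕂] (ΓA →ₗ[R] ΓB)} :
    P.GaugeEquivalent ξ η ↔ ∃ b ∈ mPart 𝕂 𝒜 (P.LL.Der × ΓB),
      ∃ ψ, IsNilpotent.exp (P.gaugeOp b) ∘ₗ P.graphMap ξ = P.graphMap η ∘ₗ ψ :=
  exists_congr fun _ => and_congr_right fun hb => eq_comm.trans (P.expAct_eq_iff ev hb)

theorem GaugeEquivalent.symm {P : SplitPair 𝕂 R ΓA ΓL ΓB} (ev : 𝒜 →ₐ[𝕂] 𝕂)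
    {ξ η : 𝒜 ⊗[𝕂] (ΓA →ₗ[R] ΓB)} (h : P.GaugeEquivalent ξ η) : P.GaugeEquivalent η ξ := by
  obtain ⟨b, hb, ψ, hψ⟩ := (P.gaugeEquivalent_iff ev).1 h
  obtain ⟨χ, hχ⟩ :=
    (P.isUnit_of_comp_graphMap (center_exp (P.center_gaugeOp ev hb)) hψ).exists_right_inv
  refine (P.gaugeEquivalent_iff ev).2 ⟨-b, neg_mem hb, χ, ?_⟩
  have hinv : IsNilpotent.exp (P.gaugeOp (-b)) * IsNilpotent.exp (P.gaugeOp b) = 1 := by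
    rw [map_neg, IsNilpotent.exp_neg_mul_exp_self (P.isNilpotent_gaugeOp ev hb)]
  calc IsNilpotent.exp (P.gaugeOp (-b)) ∘ₗ P.graphMap η
      = IsNilpotent.exp (P.gaugeOp (-b)) ∘ₗ (P.graphMap η ∘ₗ ψ) ∘ₗ χ := by
        rw [LinearMap.comp_assoc, ← Module.End.mul_eq_comp ψ, hχ]; rfl
    _ = (IsNilpotent.exp (P.gaugeOp (-b)) * IsNilpotent.exp (P.gaugeOp b)) ∘ₗ
          P.graphMap ξ ∘ₗ χ := by rw [← hψ]; rfl
    _ = P.graphMap ξ ∘ₗ χ := by rw [hinv]; rfl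

theorem gaugeEquivalent_iff_weaklyIsomorphic [Module ℚ (𝒜 ⊗[𝕂] R)] {ev : 𝒜 →ₐ[𝕂] 𝕂}
    {ξ η : 𝒜 ⊗[𝕂] (ΓA →ₗ[R] ΓB)} (hη : P.IsMaurerCartan η) :
    P.GaugeEquivalent ξ η ↔ P.WeaklyIsomorphic ev (P.standard ξ) (P.standard η) := by
  rw [weaklyIsomorphic_standard_iff P hη]
  simp only [exists_isSmallAut_iff_exists_gaugeOp]
  calc P.GaugeEquivalent ξ η
      ↔ P.GaugeEquivalent η ξ := ⟨fun h => h.symm ev, fun h => h.symm ev⟩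
    _ ↔ ∃ b ∈ mPart 𝕂 𝒜 (P.LL.Der × ΓB),
          ∃ ψ, IsNilpotent.exp (P.gaugeOp b) ∘ₗ P.graphMap η = P.graphMap ξ ∘ₗ ψ :=
        P.gaugeEquivalent_iff ev
    _ ↔ ∃ Φ, (∃ b ∈ mPart 𝕂 𝒜 (P.LL.Der × ΓB), IsNilpotent.exp (P.gaugeOp b) = Φ) ∧
          ∃ ψ, Φ ∘ₗ P.graphMap η = P.graphMap ξ ∘ₗ ψ :=
        ⟨fun ⟨b, hb, h⟩ => ⟨_, ⟨b, hb, rfl⟩, h⟩, fun ⟨_, ⟨b, hb, rfl⟩, h⟩ => ⟨b, hb, h⟩⟩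

end Equivalence

end SplitPair

end Gauge

end LiePairs

end

theorem mainTheorem4_general {𝕂 : Type*} [Field 𝕂] [CharZero 𝕂]
    {R : Type*} [CommRing R] [Algebra 𝕂 R]
    {ΓA : Type*} [AddCommGroup ΓA] [Module 𝕂 ΓA] [Module R ΓA] [IsScalarTower 𝕂 R ΓA]
    {ΓL : Type*} [AddCommGroup ΓL] [Module 𝕂 ΓL] [Module R ΓL] [IsScalarTower 𝕂 R ΓL]
    {ΓB : Type*} [AddCommGroup ΓB] [Module 𝕂 ΓB] [Module R ΓB] [IsScalarTower 𝕂 R ΓB]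
    (P : LiePairs.SplitPair 𝕂 R ΓA ΓL ΓB)
    {𝒜 : Type*} [CommRing 𝒜] [Algebra 𝕂 𝒜] [IsLocalRing 𝒜] [IsArtinianRing 𝒜]
    (ev : 𝒜 →ₐ[𝕂] 𝕂) {ξ η : 𝒜 ⊗[𝕂] (ΓA →ₗ[R] ΓB)}
    (hξ : P.IsMaurerCartan ξ) (hη : P.IsMaurerCartan η) :
    P.IsInfinitesimalDeformation ev (P.standard ξ) ∧
    P.IsInfinitesimalDeformation ev (P.standard η) ∧
    (P.GaugeEquivalent ξ η ↔ P.WeaklyIsomorphic ev (P.standard ξ) (P.standard η)) := by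
  let _ : Module ℚ (𝒜 ⊗[𝕂] ΓL) := Module.compHom _ (algebraMap ℚ 𝕂)
  let _ : Module ℚ (𝒜 ⊗[𝕂] R) := Module.compHom _ (algebraMap ℚ 𝕂)
  exact ⟨hξ.isInfinitesimalDeformation_standard ev, hη.isInfinitesimalDeformation_standard ev,
    P.gaugeEquivalent_iff_weaklyIsomorphic hη⟩

theorem mainTheorem4 {𝕂 : Type*} [RCLike 𝕂]
    {n : ℕ} {M : Type*} [TopologicalSpace M] [ChartedSpace (EuclideanSpace ℝ (Fin n)) M]
    [IsManifold (𝓡 n) ∞ M] [T2Space M] [SigmaCompactSpace M]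
    {FA : Type*} [NormedAddCommGroup FA] [NormedSpace 𝕂 FA] [NormedSpace ℝ FA]
    [IsScalarTower ℝ 𝕂 FA] [FiniteDimensional 𝕂 FA]
    {A : M → Type*} [∀ x, AddCommGroup (A x)] [∀ x, Module 𝕂 (A x)] [∀ x, Module ℝ (A x)]
    [∀ x, IsScalarTower ℝ 𝕂 (A x)]
    [∀ x, TopologicalSpace (A x)] [TopologicalSpace (Bundle.TotalSpace FA A)]
    [FiberBundle FA A] [VectorBundle 𝕂 FA A] [VectorBundle ℝ FA A]
    [ContMDiffVectorBundle ∞ FA A (𝓡 n)]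
    {FL : Type*} [NormedAddCommGroup FL] [NormedSpace 𝕂 FL] [NormedSpace ℝ FL]
    [IsScalarTower ℝ 𝕂 FL] [FiniteDimensional 𝕂 FL]
    {L : M → Type*} [∀ x, AddCommGroup (L x)] [∀ x, Module 𝕂 (L x)] [∀ x, Module ℝ (L x)]
    [∀ x, IsScalarTower ℝ 𝕂 (L x)]
    [∀ x, TopologicalSpace (L x)] [TopologicalSpace (Bundle.TotalSpace FL L)]
    [FiberBundle FL L] [VectorBundle 𝕂 FL L] [VectorBundle ℝ FL L]
    [ContMDiffVectorBundle ∞ FL L (𝓡 n)]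
    {FB : Type*} [NormedAddCommGroup FB] [NormedSpace 𝕂 FB] [NormedSpace ℝ FB]
    [IsScalarTower ℝ 𝕂 FB] [FiniteDimensional 𝕂 FB]
    {B : M → Type*} [∀ x, AddCommGroup (B x)] [∀ x, Module 𝕂 (B x)] [∀ x, Module ℝ (B x)]
    [∀ x, IsScalarTower ℝ 𝕂 (B x)]
    [∀ x, TopologicalSpace (B x)] [TopologicalSpace (Bundle.TotalSpace FB B)]
    [FiberBundle FB B] [VectorBundle 𝕂 FB B] [VectorBundle ℝ FB B]
    [ContMDiffVectorBundle ∞ FB B (𝓡 n)]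
    (P : LiePairs.LiePair 𝕂 (𝓡 n) FA A FL L FB B)
    {𝒜 : Type*} [CommRing 𝒜] [Algebra 𝕂 𝒜] [IsLocalRing 𝒜] [IsArtinianRing 𝒜]
    (ev : 𝒜 →ₐ[𝕂] 𝕂)
    (ξ η : 𝒜 ⊗[𝕂] (LiePairs.Sec 𝕂 (𝓡 n) FA A →ₗ[LiePairs.SmoothFun 𝕂 (𝓡 n) M]
      LiePairs.Sec 𝕂 (𝓡 n) FB B))
    (hξ : P.sections.IsMaurerCartan ξ) (hη : P.sections.IsMaurerCartan η) :
    P.sections.IsInfinitesimalDeformation ev (P.sections.standard ξ) ∧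
    P.sections.IsInfinitesimalDeformation ev (P.sections.standard η) ∧
    (P.sections.GaugeEquivalent ξ η ↔
      P.sections.WeaklyIsomorphic ev (P.sections.standard ξ) (P.sections.standard η)) :=
  mainTheorem4_general P.sections ev hξ hη
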